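/- Let $\mathcal X,\mathcal Y,\mathcal W$ be measurable spaces, and let $\nu_Y,\nu_W$ be $\sigma$-finite reference measures on $\mathcal Y,\mathcal W$. Let $p_{Y|X}(y|x)$ and $p_{W|X}(w|x)$ be jointly measurable transition densities with respect to $\nu_Y$ and $\nu_W$: the channels to the receiver and to the detector, both used without memory. Let $x_0\in\mathcal X$ be the innocent symbol, $P_{\tilde X}$ any probability measure on $\mathcal X$, and $p_{\tilde W}(w)=\int p_{W|X}(w|x)\,P_{\tilde X}(dx)$. Put $\chi^2(p\|q)=\int (p-q)^2/q\in[0,\infty]$ (with integrand $0$ where $p=q=0$ and $\infty$ where $q=0<p$) and $\chi^2=\chi^2(p_{\tilde W}\,\|\,p_{W|X=x_0})$. Let $0<\epsilon_{\rm det}<1$, $\epsilon_{\rm dec}>0$ and $\xi=e^{-\frac12\mathsf W_0(4\epsilon_{\rm det}^2)}$, where $\mathsf W_0$ is the principal branch of the Lambert function (the inverse of $w\mapsto we^w$ on $[-1,\infty)$). For each block length $n$ use the sparse signalling distribution $P_n=(1-\tau_n)\delta_{x_0}+\tau_nP_{\tilde X}$ with $\tau_n=\min\{1,\,2\xi\epsilon_{\rm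 det}/\sqrt{n\chi^2}\}$. Then there are positive integers $M_n$ $(n\ge 0)$ such that, for every $n$, when the $M_n$ code words of length $n$ are drawn independently with i.i.d. symbols of law $P_n$: (i) every (possibly randomised) test of a detector, which knows $P_n$ but not the code book, between $\mathcal H_0$ (the word $(x_0,\dots,x_0)$ is sent; output law $p_{W^n|X^n=(x_0,\dots,x_0)}$) and $\mathcal H_1$ (output law $p_{W^n}=\prod_{i=1}^n p_W$, where $p_W$ is the output density for input law $P_n$) has false plus miss detection probability $\alpha+\beta\ge 1-\epsilon_{\rm det}$; moreover $d_{\rm TV}(p_{W^n},p_{W^n|X^n=(x_0,\dots,x_0)})=\frac12\int|p_{W^n}-p_{W^n|X^n=(x_0,\dots,x_0)}|\le\epsilon_{\rm det}$; (ii) with suitable decoders, depending measurably on the code book and on the received word, the decoding error probability of the receiver, averaged over equally likely messages and over the random code book, is at most $\epsilon_{\rm dec}$, and with positive probability the drawn code has average decoding error probability at most $\epsilon_{\rm dec}$; and the limit of $\log_2M_n/(\epsilon_{\rm det}\sqrt n)$ exists in $[0,\infty]$ and satisfies $$\lim_{n\to\infty}\frac{\log_2 M_n}{\epsilon_{\rm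 det}\sqrt n}\ \ge\ \frac{2\xi}{\log 2}\,\frac{I(\tilde X;Y)}{\sqrt{\chi^2(p_{\tilde W}\|p_{W|X=x_0})}},$$ where $I(\tilde X;Y)\in[0,\infty]$ is the mutual information (natural logarithm) of input and output of $p_{Y|X}$ for the input law $P_{\tilde X}$. (Degenerate cases: $a/\infty=0$ for all $a\in[0,\infty]$, $a/0=\infty$ for $a>0$, and $0/0=0$.) -/

import Mathlib

open MeasureTheory Filter Topology InformationTheory
open scoped ENNReal NNReal

noncomputable section

/-- A (single-use) channel from `X` to `Y` given by transition densities `p(y|x)` with respect to a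
reference measure `ν` on `Y` (Lebesgue measure, counting measure, ...). -/
structure DensityChannel (X Y : Type*) [MeasurableSpace X] [MeasurableSpace Y]
    (ν : Measure Y) where
  /-- the transition density `p(y|x)` -/
  dens : X → Y → ℝ≥0
  measurable_dens : Measurable (Function.uncurry dens)
  lintegral_dens : ∀ x, ∫⁻ y, (dens x y : ℝ≥0∞) ∂ν = 1

namespace DensityChannel

variable {X Y : Type*} [MeasurableSpace X] [MeasurableSpace Y] {ν : Measure Y}

/-- The output density `p_Y(y) = ∫ p(y|x) P(dx)` induced by the input distribution `P`. -/
def outDens (p : DensityChannel X Y ν) (P : Measure X) (y : Y) : ℝ≥0∞ :=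
  ∫⁻ x, (p.dens x y : ℝ≥0∞) ∂P

/-- The law of the output when the channel input is `x`. -/
def condLaw (p : DensityChannel X Y ν) (x : X) : Measure Y :=
  ν.withDensity fun y => (p.dens x y : ℝ≥0∞)

/-- The law of the output when the channel input has distribution `P`. -/
def outLaw (p : DensityChannel X Y ν) (P : Measure X) : Measure Y :=
  ν.withDensity (p.outDens P)

/-- The joint law of (input, output) when the channel input has distribution `P`. -/
def jointLaw (p : DensityChannel X Y ν) (P : Measure X) : Measure (X × Y) :=
  (P.prod ν).withDensity fun z => (p.dens z.1 z.2 : ℝ≥0∞)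

/-- The mutual information (in nats) between input and output for the input distribution `P`:
the integral of `log (p_XY / (p_X p_Y))` against the joint law, in `[0, ∞]`. -/
def mutualInfo (p : DensityChannel X Y ν) (P : Measure X) : ℝ≥0∞ :=
  klDiv (p.jointLaw P) (P.prod (p.outLaw P))

/-- The law of the output block when the word `x` is sent over `n` memoryless uses. -/
def blockLaw (p : DensityChannel X Y ν) {n : ℕ} (x : Fin n → X) : Measure (Fin n → Y) :=
  Measure.pi fun i => p.condLaw (x i)

/-- Average (over `M` equally likely messages) decoding error probability of the code book `c`
with decoder `g` over `n` memoryless uses of the channel. -/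
def avgError (p : DensityChannel X Y ν) {n M : ℕ} (c : Fin M → Fin n → X)
    (g : (Fin n → Y) → Fin M) : ℝ≥0∞ :=
  (∑ m, p.blockLaw (c m) {y | g y ≠ m}) / M

end DensityChannel

/-- Chi-squared distance `∫ (p - q)² / q dν` of two densities, in `[0, ∞]`; the integrand is `0`
where `p = q = 0` and `∞` where `q = 0 < p`. -/
def chiSq {Ω : Type*} [MeasurableSpace Ω] (ν : Measure Ω) (p q : Ω → ℝ≥0∞) : ℝ≥0∞ :=
  ∫⁻ w, ENNReal.ofReal (((p w).toReal - (q w).toReal) ^ 2) / q w ∂ν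

/-- Variational distance `½ ∫ |p - q| dν` of two densities. -/
def tvDist {Ω : Type*} [MeasurableSpace Ω] (ν : Measure Ω) (p q : Ω → ℝ≥0∞) : ℝ≥0∞ :=
  (∫⁻ w, ENNReal.ofReal |(p w).toReal - (q w).toReal| ∂ν) / 2

/-- Principal branch of the Lambert W function: the `w ≥ -1` with `w * exp w = z`
(for `z ≥ -1/e`). -/
def lambertW0 (z : ℝ) : ℝ :=
  Function.invFunOn (fun w : ℝ => w * Real.exp w) (Set.Ici (-1)) z

/-- `ξ = exp (-½ W₀(4 ε²))`. -/
def xiConst (ε : ℝ) : ℝ := Real.exp (-(1 / 2) * lambertW0 (4 * ε ^ 2))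

/-- Sparse signalling distribution `(1 - τ) δ_{x₀} + τ P` with kernel `P`. -/
def sparseLaw {X : Type*} [MeasurableSpace X] (x₀ : X) (P : Measure X) (τ : ℝ≥0∞) : Measure X :=
  (1 - τ) • Measure.dirac x₀ + τ • P

/-- Random code book: `M` independent code words of length `n` with i.i.d. symbols of law `Q`. -/
def codeEnsemble {X : Type*} [MeasurableSpace X] (Q : Measure X) (n M : ℕ) :
    Measure (Fin M → Fin n → X) :=
  Measure.pi fun _ => Measure.pi fun _ => Q

/-- The largest sparseness factor `τ ∈ [0, 1]` with `τ ≤ 2 ξ ε / √(n χ²)`. -/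
def sparseness (ε : ℝ) (χ2 : ℝ≥0∞) (n : ℕ) : ℝ≥0∞ :=
  min 1 (ENNReal.ofReal (2 * xiConst ε * ε) / ((n : ℝ≥0∞) * χ2) ^ (1 / 2 : ℝ))

/-- Low probability of detection at block length `n` and level `ε`, when the code words are drawn
with i.i.d. symbols of law `Q`, for a detector that knows `Q` but not the code book.
Under `H₀` its observation has the law `p_{W^n|X^n=(x₀,…,x₀)}`, under `H₁` the law `p_{W^n}`, the
product of the output laws for input law `Q`. Every (possibly randomised) test `φ` (the
probability of deciding `H₁`) has false plus miss detection probability `α + β ≥ 1 - ε`, and the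
variational distance of the two laws is at most `ε`. -/
def IsLPD {X W : Type*} [MeasurableSpace X] [MeasurableSpace W] {ν : Measure W}
    (p : DensityChannel X W ν) (x₀ : X) (Q : Measure X) (n : ℕ) (ε : ℝ) : Prop :=
  (∀ φ : (Fin n → W) → ℝ≥0∞, Measurable φ → (∀ w, φ w ≤ 1) →
    ENNReal.ofReal (1 - ε) ≤
      ∫⁻ w, φ w ∂(p.blockLaw fun _ : Fin n => x₀)
        + ∫⁻ w, (1 - φ w) ∂(Measure.pi fun _ : Fin n => p.outLaw Q)) ∧
  tvDist (Measure.pi fun _ : Fin n => ν)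
    (fun w => ∏ i, p.outDens Q (w i)) (fun w => ∏ i, (p.dens x₀ (w i) : ℝ≥0∞))
      ≤ ENNReal.ofReal ε

/-- `M` messages can be sent reliably in `n` uses with code words drawn with i.i.d. symbols of
law `Q`: for some choice of decoders, the decoding error averaged over the random code book is at
most `ε`, and (with positive probability under the code-book distribution) there is a code whose
average decoding error is at most `ε`. -/
def IsReliable {X Y : Type*} [MeasurableSpace X] [MeasurableSpace Y] {ν : Measure Y}
    (p : DensityChannel X Y ν) (Q : Measure X) (n M : ℕ) (ε : ℝ) : Prop :=
  ∃ dec : (Fin M → Fin n → X) → (Fin n → Y) → Fin M,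
    Measurable (Function.uncurry dec) ∧
    ∫⁻ c, p.avgError c (dec c) ∂(codeEnsemble Q n M) ≤ ENNReal.ofReal ε ∧
    codeEnsemble Q n M {c | p.avgError c (dec c) ≤ ENNReal.ofReal ε} ≠ 0

end

/-! Undetectability is a χ² estimate. Writing `f` and `g` for the block output densities under the
two hypotheses, `∫ f²/g = (1 + τ²χ²)^n ≤ exp (nτ²χ²)`, and the sparseness keeps `nτ²χ²` below
`(2ξε)² = w`, where `w = W₀(4ε²)`. Since `w e^w = 4ε²` forces `e^w ≤ 1 + 4ε²`, the block χ² distance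
is at most `4ε²`. Hence the variational distance is at most `ε`, and every test has total error at
least `1 - ε` (`isLPD_sparseLaw`).

Reliability is random coding with a likelihood-ratio threshold `T`. Its mean error is at most `T^l
H^n + M/T`, where `H = ∫∫ p(y|x)^(1-l) p_Q(y)^l` (`isReliable_of_le`). The input law `Q` varies with
`n`, so `p_Q` is exchanged for the output density of the fixed law `P` by weighted AM-GM. For `l =
m/(1+m)` this gives `H ≤ 1 - τ l J_m` (`hellingerIntegral_sparseLaw_le_exp`), where `J_m` is
`tiltDiv` of order `m`, always finite.

Fatou's lemma gives `liminf J_m ≥ I` as `m → 0` (`exists_lt_tiltDiv`), so no moment condition is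
needed and `I = ∞` is covered. With `τ ≈ c/√n`, `c = 2ξε/√χ²`, and `T = exp (R'√n)`, both error
terms vanish for `M ≈ exp (R√n)` whenever `R < R' < c J_m`; thus every `R < cI` is achievable. A
diagonal sequence of rates tending to `cI` makes the limit exist and equal `cI`, up to the
conversion to bits and the division by `ε`. -/

/-! ### Integrals and densities on finite products -/

theorem lintegral_pi_prod_eq_prod_lintegral {n : ℕ} {E : Fin n → Type*}
    [∀ i, MeasurableSpace (E i)] (μ : ∀ i, Measure (E i)) [∀ i, SigmaFinite (μ i)]
    (f : ∀ i, E i → ℝ≥0∞) (hf : ∀ i, Measurable (f i)) :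
    ∫⁻ w, ∏ i, f i (w i) ∂(Measure.pi μ) = ∏ i, ∫⁻ x, f i x ∂(μ i) := by
  induction n with
  | zero => simp
  | succ n ih =>
    have hmp := (measurePreserving_piFinSuccAbove μ 0).symm _
    rw [← hmp.lintegral_comp_emb (MeasurableEquiv.measurableEmbedding _)]
    simp only [Fin.prod_univ_succAbove _ 0]
    have e : ∀ a : E 0 × (∀ j, E (Fin.succAbove 0 j)),
        f 0 ((MeasurableEquiv.piFinSuccAbove E 0).symm a 0) *
          ∏ i : Fin n, f (Fin.succAbove 0 i) ((MeasurableEquiv.piFinSuccAbove E 0).symm a (Fin.succAbove 0 i)) =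
        f 0 a.1 * ∏ i : Fin n, f (Fin.succAbove 0 i) (a.2 i) := by
      intro a
      rfl
    simp_rw [e]
    have hm : Measurable fun w : ∀ i : Fin n, E (Fin.succAbove 0 i) =>
        ∏ i, f (Fin.succAbove 0 i) (w i) :=
      Finset.measurable_prod _ fun i _ => (hf _).comp (measurable_pi_apply i)
    rw [lintegral_prod_mul (hf 0).aemeasurable hm.aemeasurable]
    congr 1
    exact ih (fun i => μ (Fin.succAbove 0 i)) (fun i => f (Fin.succAbove 0 i)) fun i => hf _

/-- It suffices to compare on boxes, where the indicator of the box factors along with the density.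
-/
theorem pi_withDensity {n : ℕ} {E : Fin n → Type*}
    [∀ i, MeasurableSpace (E i)] (μ : ∀ i, Measure (E i)) [∀ i, SigmaFinite (μ i)]
    (f : ∀ i, E i → ℝ≥0∞) (hf : ∀ i, Measurable (f i))
    [∀ i, SigmaFinite ((μ i).withDensity (f i))] :
    Measure.pi (fun i => (μ i).withDensity (f i)) =
      (Measure.pi μ).withDensity fun w => ∏ i, f i (w i) := by
  refine Measure.pi_eq fun s hs => ?_
  rw [withDensity_apply _ (MeasurableSet.univ_pi hs), ← lintegral_indicator (MeasurableSet.univ_pi hs)]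
  have : ∀ w, (Set.univ.pi s).indicator (fun w => ∏ i, f i (w i)) w =
      ∏ i, (s i).indicator (f i) (w i) := by
    intro w
    by_cases h : w ∈ Set.univ.pi s
    · rw [Set.indicator_of_mem h]
      exact Finset.prod_congr rfl fun i _ => by rw [Set.indicator_of_mem (h i trivial)]
    · rw [Set.indicator_of_notMem h]
      simp only [Set.mem_pi, Set.mem_univ, forall_const, not_forall] at h
      obtain ⟨i, hi⟩ := h
      exact (Finset.prod_eq_zero (Finset.mem_univ i) (by rw [Set.indicator_of_notMem hi])).symm
  simp_rw [this]
  rw [lintegral_pi_prod_eq_prod_lintegral μ _ fun i => (hf i).indicator (hs i)]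
  exact Finset.prod_congr rfl fun i _ => by
    rw [lintegral_indicator (hs i), withDensity_apply _ (hs i)]

/-! ### Output laws and memoryless extension of a channel -/

namespace DensityChannel

variable {X Y : Type*} [MeasurableSpace X] [MeasurableSpace Y] {ν : Measure Y}
  (p : DensityChannel X Y ν)

theorem measurable_dens_coe : Measurable fun z : X × Y => (p.dens z.1 z.2 : ℝ≥0∞) :=
  p.measurable_dens.coe_nnreal_ennreal

theorem measurable_dens_right (x : X) : Measurable fun y => (p.dens x y : ℝ≥0∞) :=
  p.measurable_dens_coe.comp measurable_prodMk_left

theorem measurable_dens_left (y : Y) : Measurable fun x => (p.dens x y : ℝ≥0∞) :=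
  p.measurable_dens_coe.comp measurable_prodMk_right

theorem measurable_outDens (P : Measure X) [SFinite P] : Measurable (p.outDens P) :=
  p.measurable_dens_coe.lintegral_prod_left'

theorem lintegral_outDens (P : Measure X) [IsProbabilityMeasure P] [SFinite ν] :
    ∫⁻ y, p.outDens P y ∂ν = 1 := by
  unfold outDens
  have h : Measurable (Function.uncurry fun (y : Y) (x : X) => (p.dens x y : ℝ≥0∞)) :=
    p.measurable_dens_coe.comp measurable_swap
  rw [lintegral_lintegral_swap h.aemeasurable]
  simp [p.lintegral_dens]

instance isProbabilityMeasure_condLaw (x : X) : IsProbabilityMeasure (p.condLaw x) :=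
  ⟨by rw [condLaw, withDensity_apply _ .univ, setLIntegral_univ, p.lintegral_dens]⟩

instance isProbabilityMeasure_outLaw (P : Measure X) [IsProbabilityMeasure P] [SFinite ν] :
    IsProbabilityMeasure (p.outLaw P) :=
  ⟨by rw [outLaw, withDensity_apply _ .univ, setLIntegral_univ, p.lintegral_outDens]⟩

theorem ae_outDens_lt_top (P : Measure X) [IsProbabilityMeasure P] [SFinite ν] :
    ∀ᵐ y ∂ν, p.outDens P y < ∞ :=
  ae_lt_top (p.measurable_outDens P) (by simp [p.lintegral_outDens])

/-- The `n`-fold memoryless extension of a channel. -/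
def block (p : DensityChannel X Y ν) [SigmaFinite ν] (n : ℕ) :
    DensityChannel (Fin n → X) (Fin n → Y) (Measure.pi fun _ => ν) where
  dens x y := ∏ i, p.dens (x i) (y i)
  measurable_dens := by
    refine Finset.measurable_prod _ fun i _ => ?_
    have h : Measurable fun z : (Fin n → X) × (Fin n → Y) => (z.1 i, z.2 i) := by fun_prop
    exact p.measurable_dens.comp h
  lintegral_dens x := by
    simp only [ENNReal.ofNNReal_finsetProd]
    rw [lintegral_pi_prod_eq_prod_lintegral _ _ fun i => p.measurable_dens_right (x i)]
    simp [p.lintegral_dens]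

theorem block_condLaw [SigmaFinite ν] {n : ℕ} (x : Fin n → X) :
    (p.block n).condLaw x = p.blockLaw x := by
  have : ∀ i, IsProbabilityMeasure (ν.withDensity fun y => (p.dens (x i) y : ℝ≥0∞)) :=
    fun i => p.isProbabilityMeasure_condLaw (x i)
  simp only [condLaw, blockLaw, block, ENNReal.ofNNReal_finsetProd]
  rw [pi_withDensity _ _ fun i => p.measurable_dens_right (x i)]

theorem block_outDens [SigmaFinite ν] {n : ℕ} (Q : Measure X) [SigmaFinite Q] (y : Fin n → Y) :
    (p.block n).outDens (Measure.pi fun _ => Q) y = ∏ i, p.outDens Q (y i) := by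
  simp only [outDens, block, ENNReal.ofNNReal_finsetProd]
  exact lintegral_pi_prod_eq_prod_lintegral _ _ fun i => p.measurable_dens_left (y i)

theorem pi_outLaw [SigmaFinite ν] {n : ℕ} (Q : Measure X) [IsProbabilityMeasure Q] :
    Measure.pi (fun _ : Fin n => p.outLaw Q) =
      (p.block n).outLaw (Measure.pi fun _ => Q) := by
  have : IsProbabilityMeasure (ν.withDensity (p.outDens Q)) := p.isProbabilityMeasure_outLaw Q
  unfold outLaw
  rw [pi_withDensity _ _ fun _ => p.measurable_outDens Q]
  congr 1
  ext y
  rw [p.block_outDens]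

end DensityChannel

/-! ### The sparse law and the Lambert constant -/

theorem isProbabilityMeasure_sparseLaw {X : Type*} [MeasurableSpace X] (x₀ : X) (P : Measure X)
    [IsProbabilityMeasure P] {τ : ℝ≥0∞} (hτ : τ ≤ 1) :
    IsProbabilityMeasure (sparseLaw x₀ P τ) :=
  ⟨by simp [sparseLaw, tsub_add_cancel_of_le hτ]⟩

theorem sparseness_le_one (ε : ℝ) (χ2 : ℝ≥0∞) (n : ℕ) : sparseness ε χ2 n ≤ 1 := min_le_left _ _

theorem DensityChannel.outDens_sparseLaw {X Y : Type*} [MeasurableSpace X] [MeasurableSpace Y]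
    {ν : Measure Y} (p : DensityChannel X Y ν) (x₀ : X) (P : Measure X) (τ : ℝ≥0∞) (y : Y) :
    p.outDens (sparseLaw x₀ P τ) y = (1 - τ) * p.dens x₀ y + τ * p.outDens P y := by
  simp only [outDens, sparseLaw, lintegral_add_measure, lintegral_smul_measure, smul_eq_mul]
  -- Singletons of `X` need not be measurable; measurability of the integrand is what evaluates the
  -- Dirac integral.
  rw [lintegral_dirac' _ (p.measurable_dens_left y)]

theorem lambertW0_mul_exp {z : ℝ} (hz : 0 ≤ z) : lambertW0 z * Real.exp (lambertW0 z) = z := by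
  refine Function.invFunOn_eq (f := fun w : ℝ => w * Real.exp w) ?_
  have hc : ContinuousOn (fun w : ℝ => w * Real.exp w) (Set.Icc 0 z) := by fun_prop
  have h1 : z ≤ z * Real.exp z := le_mul_of_one_le_right hz (Real.one_le_exp hz)
  obtain ⟨w, hw, h⟩ := intermediate_value_Icc hz hc ⟨by simpa using hz, h1⟩
  exact ⟨w, le_trans (by norm_num) hw.1, h⟩

/-- With `w = W₀(4ε²)` one has `ξ² = e^(-w)`, so the exponent is `w e^w e^(-w) = w`. The claim
becomes `e^w ≤ 1 + w e^w`, which is `1 - w ≤ e^(-w)` multiplied by `e^w`. -/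
theorem exp_four_mul_xiConst_sq_le (ε : ℝ) :
    Real.exp ((2 * xiConst ε * ε) ^ 2) ≤ 1 + 4 * ε ^ 2 := by
  have hW := lambertW0_mul_exp (z := 4 * ε ^ 2) (by positivity)
  set w := lambertW0 (4 * ε ^ 2) with hw
  have h1 : (2 * xiConst ε * ε) ^ 2 = w := by
    have : xiConst ε ^ 2 = Real.exp (-w) := by
      rw [xiConst, ← hw, ← Real.exp_nat_mul]
      congr 1
      push_cast
      ring
    calc (2 * xiConst ε * ε) ^ 2 = xiConst ε ^ 2 * (4 * ε ^ 2) := by ring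
      _ = w * (Real.exp (-w) * Real.exp w) := by rw [this, ← hW]; ring
      _ = w := by rw [← Real.exp_add]; simp
  rw [h1, ← hW]
  have h2 := Real.add_one_le_exp (-w)
  have h3 : Real.exp (-w) * Real.exp w = 1 := by rw [← Real.exp_add]; simp
  nlinarith [Real.exp_pos w]

/-! ### χ² distance, variational distance and tests -/

/-- For `b > 0` the difference of the two sides is `(|a - b| - 2εb)² / b`. Integrated, this replaces
Cauchy-Schwarz; all terms are kept positive to avoid truncated subtraction. -/
theorem mul_abs_sub_add_le_sq_div_add {ε : ℝ} (hε : 0 ≤ ε) {a b : ℝ≥0∞} (ha : a ≠ ∞)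
    (hb : b ≠ ∞) :
    ENNReal.ofReal (4 * ε) * ENNReal.ofReal |a.toReal - b.toReal| + 2 * a ≤
      a ^ 2 / b + b + ENNReal.ofReal (4 * ε ^ 2) * b := by
  by_cases hb0 : b = 0
  · by_cases ha0 : a = 0
    · simp [ha0, hb0]
    · simp [hb0, ENNReal.div_zero (pow_ne_zero 2 ha0)]
  obtain ⟨x, hx, rfl⟩ : ∃ x : ℝ, 0 ≤ x ∧ a = ENNReal.ofReal x :=
    ⟨a.toReal, ENNReal.toReal_nonneg, (ENNReal.ofReal_toReal ha).symm⟩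
  obtain ⟨y, hy, rfl⟩ : ∃ y : ℝ, 0 < y ∧ b = ENNReal.ofReal y :=
    ⟨b.toReal, ENNReal.toReal_pos hb0 hb, (ENNReal.ofReal_toReal hb).symm⟩
  rw [ENNReal.toReal_ofReal hx, ENNReal.toReal_ofReal hy.le,
    ← ENNReal.ofReal_pow hx, ← ENNReal.ofReal_div_of_pos hy,
    ← ENNReal.ofReal_mul (by positivity), ← ENNReal.ofReal_mul (by positivity),
    ← ENNReal.ofReal_add (by positivity) hy.le, ← ENNReal.ofReal_add (by positivity) (by positivity),
    show (2 : ℝ≥0∞) = ENNReal.ofReal 2 by simp, ← ENNReal.ofReal_mul (by positivity),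
    ← ENNReal.ofReal_add (by positivity) (by positivity)]
  refine ENNReal.ofReal_le_ofReal ?_
  rw [← sub_nonneg]
  have : x ^ 2 / y + y + 4 * ε ^ 2 * y - (4 * ε * |x - y| + 2 * x) =
      (|x - y| - 2 * ε * y) ^ 2 / y := by
    have h := sq_abs (x - y)
    rw [sub_sq, h]
    field_simp
    ring
  rw [this]
  positivity

theorem tvDist_le_of_lintegral_sq_div_le {Ω : Type*} [MeasurableSpace Ω] {ν : Measure Ω}
    {f g : Ω → ℝ≥0∞} (hf : Measurable f) (hg : Measurable g) (hf1 : ∫⁻ w, f w ∂ν = 1)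
    (hg1 : ∫⁻ w, g w ∂ν = 1) {ε : ℝ} (hε : 0 < ε)
    (h : ∫⁻ w, f w ^ 2 / g w ∂ν ≤ ENNReal.ofReal (1 + 4 * ε ^ 2)) :
    tvDist ν f g ≤ ENNReal.ofReal ε := by
  have hft := ae_lt_top hf (μ := ν) (by simp [hf1])
  have hgt := ae_lt_top hg (μ := ν) (by simp [hg1])
  have key : ∫⁻ w, (ENNReal.ofReal (4 * ε) * ENNReal.ofReal |(f w).toReal - (g w).toReal|
      + 2 * f w) ∂ν ≤ ∫⁻ w, (f w ^ 2 / g w + g w + ENNReal.ofReal (4 * ε ^ 2) * g w) ∂ν := by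
    refine lintegral_mono_ae ?_
    filter_upwards [hft, hgt] with w h1 h2
    exact mul_abs_sub_add_le_sq_div_add hε.le h1.ne h2.ne
  have hm : Measurable fun w => ENNReal.ofReal |(f w).toReal - (g w).toReal| := by
    have : Measurable fun w => (f w).toReal - (g w).toReal := hf.ennreal_toReal.sub hg.ennreal_toReal
    exact (measurable_abs.comp this).ennreal_ofReal
  rw [lintegral_add_right _ (by fun_prop), lintegral_add_right _ (by fun_prop),
    lintegral_add_right _ hg, lintegral_const_mul _ hm, lintegral_const_mul _ hf,
    lintegral_const_mul _ hg, hf1, hg1, mul_one, mul_one] at key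
  set T := ∫⁻ w, ENNReal.ofReal |(f w).toReal - (g w).toReal| ∂ν with hT
  -- Both densities have mass one, so the integrated inequality reads `4εT + 2 ≤ (1 + 4ε²) + 1 +
  -- 4ε²`, that is `T ≤ 2ε`.
  have h2 : ENNReal.ofReal (4 * ε) * T + 2 ≤ ENNReal.ofReal (4 * ε) * ENNReal.ofReal (2 * ε) + 2 := by
    refine key.trans ((add_le_add_left (add_le_add_left h _) _).trans_eq ?_)
    rw [← ENNReal.ofReal_mul (by positivity), show (2 : ℝ≥0∞) = ENNReal.ofReal 2 by simp,
      show (1 : ℝ≥0∞) = ENNReal.ofReal 1 by simp, ← ENNReal.ofReal_add (by positivity) (by positivity),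
      ← ENNReal.ofReal_add (by positivity) (by positivity),
      ← ENNReal.ofReal_add (by positivity) (by positivity)]
    congr 1
    ring
  have h3 := (ENNReal.mul_le_mul_iff_right (by simpa using hε) ENNReal.ofReal_ne_top).1
    ((ENNReal.add_le_add_iff_right (by simp)).1 h2)
  rw [tvDist, ← hT]
  refine ENNReal.div_le_of_le_mul (h3.trans_eq ?_)
  rw [mul_comm, ENNReal.ofReal_mul hε.le]
  simp

/-- Here `a + b - |a - b| = 2 min a b`, and `b t + a (1 - t)` is a convex combination of `a` and
`b`, hence at least the minimum. -/
theorem add_le_test_add_abs_sub {a b t : ℝ≥0∞} (ha : a ≠ ∞) (hb : b ≠ ∞) (ht : t ≤ 1) :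
    a + b ≤ 2 * (b * t + a * (1 - t)) + ENNReal.ofReal |a.toReal - b.toReal| := by
  lift a to ℝ≥0 using ha
  lift b to ℝ≥0 using hb
  lift t to ℝ≥0 using ne_top_of_le_ne_top ENNReal.one_ne_top ht
  have ht' : t ≤ 1 := by exact_mod_cast ht
  have ht1 : (t : ℝ) ≤ 1 := by exact_mod_cast ht'
  have : ENNReal.ofReal |(a : ℝ≥0∞).toReal - (b : ℝ≥0∞).toReal| =
      ((Real.toNNReal |(a : ℝ) - b| : ℝ≥0) : ℝ≥0∞) := rfl
  rw [this]
  norm_cast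
  rw [← NNReal.coe_le_coe]
  push_cast [Real.coe_toNNReal _ (abs_nonneg _), NNReal.coe_sub ht']
  have h0 : (0 : ℝ) ≤ t := t.2
  have h1 := le_abs_self ((a : ℝ) - b)
  have h2 := neg_abs_le ((a : ℝ) - b)
  nlinarith

theorem one_sub_le_test_of_tvDist_le {Ω : Type*} [MeasurableSpace Ω] {ν : Measure Ω}
    {f g : Ω → ℝ≥0∞} (hf : Measurable f) (hg : Measurable g) (hf1 : ∫⁻ w, f w ∂ν = 1)
    (hg1 : ∫⁻ w, g w ∂ν = 1) {ε : ℝ} (hε : 0 < ε) (h : tvDist ν f g ≤ ENNReal.ofReal ε)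
    {φ : Ω → ℝ≥0∞} (hφ : Measurable φ) (hφ1 : ∀ w, φ w ≤ 1) :
    ENNReal.ofReal (1 - ε) ≤
      ∫⁻ w, φ w ∂(ν.withDensity g) + ∫⁻ w, (1 - φ w) ∂(ν.withDensity f) := by
  have hφ' : Measurable fun w => 1 - φ w := measurable_const.sub hφ
  rw [lintegral_withDensity_eq_lintegral_mul _ hg hφ,
    lintegral_withDensity_eq_lintegral_mul _ hf hφ']
  have hft := ae_lt_top hf (μ := ν) (by simp [hf1])
  have hgt := ae_lt_top hg (μ := ν) (by simp [hg1])
  have key : ∫⁻ w, (f w + g w) ∂ν ≤ ∫⁻ w, (2 * (g w * φ w + f w * (1 - φ w)) +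
      ENNReal.ofReal |(f w).toReal - (g w).toReal|) ∂ν := by
    refine lintegral_mono_ae ?_
    filter_upwards [hft, hgt] with w h1 h2
    exact add_le_test_add_abs_sub h1.ne h2.ne (hφ1 w)
  rw [lintegral_add_left hf, lintegral_add_left (by fun_prop), lintegral_const_mul _ (by fun_prop),
    lintegral_add_left (by fun_prop), hf1, hg1] at key
  simp only [Pi.mul_apply]
  set A := ∫⁻ w, g w * φ w ∂ν + ∫⁻ w, f w * (1 - φ w) ∂ν
  have hT : ∫⁻ w, ENNReal.ofReal |(f w).toReal - (g w).toReal| ∂ν ≤ 2 * ENNReal.ofReal ε := by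
    rw [mul_comm]
    exact (ENNReal.div_le_iff_le_mul (by simp) (by simp)).1 h
  have h2 : 2 * 1 ≤ 2 * (A + ENNReal.ofReal ε) := by
    rw [mul_add, mul_one, ← one_add_one_eq_two]
    rw [one_add_one_eq_two] at key ⊢
    exact key.trans (add_le_add_right hT _)
  have h3 := (ENNReal.mul_le_mul_iff_right (by simp) (by simp)).1 h2
  rw [ENNReal.ofReal_sub _ hε.le, ENNReal.ofReal_one]
  exact tsub_le_iff_right.2 h3

/-! ### χ² of the sparse mixture and its tensorisation -/

/-- The deviation of the mixture from `q` is `τ (a - q)`; the rest is the expansion of a square,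
with the cross term moved across. If `q = 0` and `τ a ≠ 0`, both sides are infinite. -/
theorem sq_div_add_mixture {q : ℝ≥0} {a τ : ℝ≥0∞} (ha : a ≠ ∞) (hτ : τ ≤ 1) :
    ((1 - τ) * q + τ * a) ^ 2 / q + q =
      τ ^ 2 * (ENNReal.ofReal ((a.toReal - (q : ℝ≥0∞).toReal) ^ 2) / q)
        + 2 * ((1 - τ) * q + τ * a) := by
  lift a to ℝ≥0 using ha
  lift τ to ℝ≥0 using ne_top_of_le_ne_top ENNReal.one_ne_top hτ
  have hτ' : τ ≤ 1 := by exact_mod_cast hτ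
  by_cases hq : q = 0
  · subst hq
    by_cases ha0 : a = 0
    · simp [ha0]
    by_cases ht0 : τ = 0
    · simp [ht0]
    have h1 : ((τ : ℝ≥0∞) * a) ^ 2 ≠ 0 := by simp [ha0, ht0]
    have h2 : (a : ℝ≥0∞) ^ 2 ≠ 0 := by simp [ha0]
    have h3 : (τ : ℝ≥0∞) ^ 2 ≠ 0 := by simp [ht0]
    simp [ENNReal.div_zero h1, ENNReal.div_zero h2, ENNReal.mul_top h3]
  have : ENNReal.ofReal (((a : ℝ≥0∞).toReal - (q : ℝ≥0∞).toReal) ^ 2) =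
      ((Real.toNNReal (((a : ℝ) - q) ^ 2) : ℝ≥0) : ℝ≥0∞) := rfl
  rw [this, ← ENNReal.coe_one, ← ENNReal.coe_sub, ← ENNReal.coe_mul, ← ENNReal.coe_mul,
    ← ENNReal.coe_add, ← ENNReal.coe_pow, ← ENNReal.coe_div hq, ← ENNReal.coe_div hq]
  norm_cast
  rw [← NNReal.coe_inj]
  push_cast [Real.coe_toNNReal _ (sq_nonneg _), NNReal.coe_sub hτ']
  have : (q : ℝ) ≠ 0 := by exact_mod_cast hq
  field_simp
  ring

theorem prod_sq_div_prod {n : ℕ} (a : Fin n → ℝ≥0∞) (q : Fin n → ℝ≥0) :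
    (∏ i, a i) ^ 2 / ((∏ i, q i : ℝ≥0) : ℝ≥0∞) = ∏ i, a i ^ 2 / q i := by
  simp only [div_eq_mul_inv, Finset.prod_mul_distrib, Finset.prod_pow]
  rw [ENNReal.ofNNReal_finsetProd, ENNReal.prod_inv_distrib]
  intro i _ j _ _
  exact Or.inr ENNReal.coe_ne_top

theorem one_add_pow_le_ofReal_exp {n : ℕ} {x : ℝ≥0∞} {v : ℝ} (hv : 0 ≤ v)
    (h : n * x ≤ ENNReal.ofReal v) : (1 + x) ^ n ≤ ENNReal.ofReal (Real.exp v) := by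
  -- For `n = 0` the hypothesis does not force `x` to be finite, because `0 * ∞ = 0`.
  rcases Nat.eq_zero_or_pos n with rfl | hn
  · simp [hv]
  have hx : x ≠ ∞ := by
    rintro rfl
    rw [ENNReal.mul_top (by exact_mod_cast hn.ne')] at h
    exact ENNReal.ofReal_ne_top (top_le_iff.1 h)
  lift x to ℝ≥0 using hx
  have h' : (n : ℝ) * x ≤ v := by
    have := ENNReal.toReal_mono ENNReal.ofReal_ne_top h
    simpa [ENNReal.toReal_ofReal hv] using this
  rw [show ((1 : ℝ≥0∞) + x) = ENNReal.ofReal (1 + x) by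
    rw [ENNReal.ofReal_add zero_le_one x.coe_nonneg]; simp, ← ENNReal.ofReal_pow (by positivity)]
  refine ENNReal.ofReal_le_ofReal ?_
  calc (1 + (x : ℝ)) ^ n ≤ Real.exp x ^ n := by
        gcongr
        linarith [Real.add_one_le_exp (x : ℝ)]
    _ = Real.exp (n * x) := (Real.exp_nat_mul _ _).symm
    _ ≤ _ := Real.exp_le_exp.2 h'

theorem natCast_mul_sparseness_sq_mul_le {ε : ℝ} (hε : 0 ≤ ε) (χ2 : ℝ≥0∞) (n : ℕ) :
    n * (sparseness ε χ2 n ^ 2 * χ2) ≤ ENNReal.ofReal ((2 * xiConst ε * ε) ^ 2) := by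
  have hx : 0 ≤ 2 * xiConst ε * ε := by
    have := (Real.exp_pos (-(1 / 2) * lambertW0 (4 * ε ^ 2))).le
    rw [xiConst]
    positivity
  have hs : ((n : ℝ≥0∞) * χ2) = (((n : ℝ≥0∞) * χ2) ^ (1 / 2 : ℝ)) ^ 2 := by
    rw [← ENNReal.rpow_natCast, ← ENNReal.rpow_mul]
    norm_num
  set s := ((n : ℝ≥0∞) * χ2) ^ (1 / 2 : ℝ)
  calc n * (sparseness ε χ2 n ^ 2 * χ2) = sparseness ε χ2 n ^ 2 * (n * χ2) := by ring
    _ = (sparseness ε χ2 n * s) ^ 2 := by rw [hs]; ring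
    _ ≤ (ENNReal.ofReal (2 * xiConst ε * ε) / s * s) ^ 2 := by
        gcongr
        exact min_le_right _ _
    _ ≤ ENNReal.ofReal (2 * xiConst ε * ε) ^ 2 := by
        gcongr
        rw [mul_comm]
        -- Valid also for `s = 0` and `s = ∞`, so degenerate values of `n χ²` need no separate
        -- treatment.
        exact ENNReal.mul_div_le
    _ = _ := (ENNReal.ofReal_pow hx 2).symm

namespace DensityChannel

variable {X W : Type*} [MeasurableSpace X] [MeasurableSpace W] {ν : Measure W} [SigmaFinite ν]
  (p : DensityChannel X W ν)

theorem lintegral_sq_div_sparseLaw (x₀ : X) (P : Measure X) [IsProbabilityMeasure P]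
    {τ : ℝ≥0∞} (hτ : τ ≤ 1) :
    ∫⁻ w, p.outDens (sparseLaw x₀ P τ) w ^ 2 / p.dens x₀ w ∂ν =
      1 + τ ^ 2 * chiSq ν (p.outDens P) fun w => (p.dens x₀ w : ℝ≥0∞) := by
  have := isProbabilityMeasure_sparseLaw x₀ P hτ
  have hm := p.measurable_outDens (sparseLaw x₀ P τ)
  have hq := p.measurable_dens_right x₀
  have key : ∫⁻ w, (p.outDens (sparseLaw x₀ P τ) w ^ 2 / p.dens x₀ w + p.dens x₀ w) ∂ν =
      ∫⁻ w, (τ ^ 2 * (ENNReal.ofReal (((p.outDens P w).toReal - (p.dens x₀ w : ℝ≥0∞).toReal) ^ 2)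
        / p.dens x₀ w) + 2 * p.outDens (sparseLaw x₀ P τ) w) ∂ν := by
    refine lintegral_congr_ae ?_
    filter_upwards [p.ae_outDens_lt_top P] with w hw
    rw [p.outDens_sparseLaw]
    exact sq_div_add_mixture hw.ne hτ
  rw [lintegral_add_right _ hq, lintegral_add_right _ (hm.const_mul _), lintegral_const_mul' _ _
    (by simpa using ne_top_of_le_ne_top ENNReal.one_ne_top hτ),
    lintegral_const_mul _ hm, p.lintegral_dens, p.lintegral_outDens, mul_one] at key
  refine (ENNReal.add_left_inj ENNReal.one_ne_top).1 (key.trans ?_)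
  rw [add_right_comm, one_add_one_eq_two, add_comm]
  rfl

end DensityChannel

theorem isLPD_sparseLaw {X W : Type*} [MeasurableSpace X] [MeasurableSpace W] {ν : Measure W}
    [SigmaFinite ν] (p : DensityChannel X W ν) (x₀ : X) (P : Measure X) [IsProbabilityMeasure P]
    {ε : ℝ} (hε : 0 < ε) (n : ℕ) :
    IsLPD p x₀ (sparseLaw x₀ P
      (sparseness ε (chiSq ν (p.outDens P) fun w => (p.dens x₀ w : ℝ≥0∞)) n)) n ε := by
  set χ2 := chiSq ν (p.outDens P) fun w => (p.dens x₀ w : ℝ≥0∞)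
  have hτ := sparseness_le_one ε χ2 n
  have := isProbabilityMeasure_sparseLaw x₀ P hτ
  set Q := sparseLaw x₀ P (sparseness ε χ2 n)
  set f : (Fin n → W) → ℝ≥0∞ := fun w => ∏ i, p.outDens Q (w i)
  set g : (Fin n → W) → ℝ≥0∞ := fun w => ∏ i, (p.dens x₀ (w i) : ℝ≥0∞)
  have hfe : f = (p.block n).outDens (Measure.pi fun _ => Q) :=
    funext fun w => (p.block_outDens Q w).symm
  have hge : g = fun w => ((p.block n).dens (fun _ => x₀) w : ℝ≥0∞) := by
    ext w
    simp [g, DensityChannel.block]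
  have hf : Measurable f := hfe ▸ (p.block n).measurable_outDens _
  have hg : Measurable g := hge ▸ (p.block n).measurable_dens_right _
  have hf1 : ∫⁻ w, f w ∂(Measure.pi fun _ => ν) = 1 := by
    rw [hfe, (p.block n).lintegral_outDens]
  have hg1 : ∫⁻ w, g w ∂(Measure.pi fun _ => ν) = 1 := by
    rw [hge, (p.block n).lintegral_dens]
  have hB : ∫⁻ w, f w ^ 2 / g w ∂(Measure.pi fun _ => ν) ≤ ENNReal.ofReal (1 + 4 * ε ^ 2) := by
    have e : ∀ w, f w ^ 2 / g w = ∏ i, (p.outDens Q (w i) ^ 2 / p.dens x₀ (w i)) := fun w => by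
      rw [← prod_sq_div_prod, ENNReal.ofNNReal_finsetProd]
    simp_rw [e]
    rw [lintegral_pi_prod_eq_prod_lintegral (fun _ => ν)
      (fun _ w => p.outDens Q w ^ 2 / p.dens x₀ w) fun _ =>
      ((p.measurable_outDens Q).pow_const 2).div (p.measurable_dens_right x₀),
      p.lintegral_sq_div_sparseLaw x₀ P hτ, Finset.prod_const, Finset.card_univ, Fintype.card_fin]
    -- The factors give `(1 + τ²χ²)^n`, and the Lambert inequality bounds the resulting exponential.
    exact (one_add_pow_le_ofReal_exp (sq_nonneg _)
      (natCast_mul_sparseness_sq_mul_le hε.le χ2 n)).trans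
      (ENNReal.ofReal_le_ofReal (exp_four_mul_xiConst_sq_le ε))
  have htv := tvDist_le_of_lintegral_sq_div_le hf hg hf1 hg1 hε hB
  refine ⟨fun φ hφ hφ1 => ?_, htv⟩
  rw [p.pi_outLaw, DensityChannel.outLaw, ← hfe, ← p.block_condLaw, DensityChannel.condLaw, ← hge]
  exact one_sub_le_test_of_tvDist_le hf hg hf1 hg1 hε htv hφ hφ1

/-! ### Random coding with a threshold decoder -/

/-- Only outcomes lying in exactly one of the sets matter to the decoder; ties and misses may be
resolved arbitrarily, here by insertion order and the default `i₀`. -/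
theorem exists_measurable_selector {Ω ι : Type*} [MeasurableSpace Ω] [MeasurableSpace ι]
    (S : ι → Set Ω) (hS : ∀ i, MeasurableSet (S i)) (i₀ : ι) (s : Finset ι) :
    ∃ g : Ω → ι, Measurable g ∧
      ∀ ω, ∀ i ∈ s, ω ∈ S i → (∀ j ∈ s, j ≠ i → ω ∉ S j) → g ω = i := by
  classical
  induction s using Finset.induction_on with
  | empty => exact ⟨fun _ => i₀, measurable_const, by simp⟩
  | insert a s ha ih =>
    obtain ⟨g, hg, h⟩ := ih
    refine ⟨fun ω => if ω ∈ S a then a else g ω, Measurable.ite (hS a) measurable_const hg, ?_⟩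
    intro ω i hi hωi hj
    by_cases hωa : ω ∈ S a
    · simp only [hωa, if_true]
      by_contra hne
      exact hj a (Finset.mem_insert_self a s) hne hωa
    · simp only [hωa, if_false]
      have hia : i ≠ a := fun e => hωa (e ▸ hωi)
      exact h ω i (Finset.mem_of_mem_insert_of_ne hi hia) hωi
        fun j hjs => hj j (Finset.mem_insert_of_mem hjs)

/-- Independence of two distinct code words: all remaining coordinates carry the factor `1`. -/
theorem lintegral_pi_mul_of_ne {X : Type*} [MeasurableSpace X] {M : ℕ} (Q : Measure X)
    [IsProbabilityMeasure Q] {m m' : Fin M} (hne : m ≠ m') {f g : X → ℝ≥0∞} (hf : Measurable f)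
    (hg : Measurable g) :
    ∫⁻ c, f (c m) * g (c m') ∂(Measure.pi fun _ : Fin M => Q) =
      (∫⁻ x, f x ∂Q) * ∫⁻ x, g x ∂Q := by
  set F : Fin M → X → ℝ≥0∞ := fun k => if k = m then f else if k = m' then g else 1 with hF
  have hFm : F m = f := if_pos rfl
  have hFm' : F m' = g := by simp [hF, hne.symm]
  have hF1 : ∀ k, k ≠ m ∧ k ≠ m' → F k = 1 := fun k hk => by simp [hF, hk.1, hk.2]
  have hmeas : ∀ k, Measurable (F k) := fun k => by
    simp only [hF]
    split_ifs
    exacts [hf, hg, measurable_one]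
  calc _ = ∫⁻ c, ∏ k, F k (c k) ∂(Measure.pi fun _ : Fin M => Q) := by
        refine lintegral_congr fun c => ?_
        rw [Fintype.prod_eq_mul m m' hne fun k hk => by rw [hF1 k hk]; rfl, hFm, hFm']
    _ = ∏ k, ∫⁻ x, F k x ∂Q := lintegral_pi_prod_eq_prod_lintegral _ F hmeas
    _ = _ := by
        rw [Fintype.prod_eq_mul m m' hne fun k hk => by rw [hF1 k hk]; simp, hFm, hFm']

namespace DensityChannel

variable {X Y : Type*} [MeasurableSpace X] [MeasurableSpace Y] {ν : Measure Y}
  (p : DensityChannel X Y ν)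

theorem condLaw_section {Ω : Type*} [MeasurableSpace Ω] (x : X) (ω : Ω) {S : Set (Ω × Y)}
    (hS : MeasurableSet S) :
    p.condLaw x {y | (ω, y) ∈ S} = ∫⁻ y, p.dens x y * S.indicator 1 (ω, y) ∂ν := by
  have hs : MeasurableSet {y | (ω, y) ∈ S} := measurable_prodMk_left hS
  rw [condLaw, withDensity_apply _ hs, ← lintegral_indicator hs]
  refine lintegral_congr fun y => ?_
  by_cases h : (ω, y) ∈ S
  · rw [Set.indicator_of_mem (s := S) h, Set.indicator_of_mem (by exact h)]
    simp
  · rw [Set.indicator_of_notMem (s := S) h, Set.indicator_of_notMem (by exact h)]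
    simp

theorem measurable_condLaw_section [SFinite ν] {Ω : Type*} [MeasurableSpace Ω] {f : Ω → X} (hf : Measurable f)
    {S : Set (Ω × Y)} (hS : MeasurableSet S) :
    Measurable fun ω => p.condLaw (f ω) {y | (ω, y) ∈ S} := by
  have h : ∀ ω, p.condLaw (f ω) {y | (ω, y) ∈ S} =
      ∫⁻ y, p.dens (f ω) y * S.indicator 1 (ω, y) ∂ν := fun ω =>
    p.condLaw_section _ _ hS
  simp_rw [h]
  refine Measurable.lintegral_prod_right' (f := fun z : Ω × Y =>
    (p.dens (f z.1) z.2 : ℝ≥0∞) * S.indicator 1 z) ?_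
  have : Measurable fun z : Ω × Y => (f z.1, z.2) := by fun_prop
  exact (p.measurable_dens_coe.comp this).mul (measurable_one.indicator hS)

/-- The pairs of a code word and a received word which pass the likelihood threshold `T`. -/
def passSet (Q : Measure X) (T : ℝ≥0∞) : Set (X × Y) :=
  {z | T * p.outDens Q z.2 < p.dens z.1 z.2}

theorem measurableSet_passSet (Q : Measure X) [SFinite Q] (T : ℝ≥0∞) :
    MeasurableSet (p.passSet Q T) :=
  measurableSet_lt (((p.measurable_outDens Q).comp measurable_snd).const_mul T)
    p.measurable_dens_coe

/-- A wrong code word passes the threshold with probability at most `1 / T`. -/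
theorem lintegral_condLaw_passSet_le [SFinite ν] (Q : Measure X) [IsProbabilityMeasure Q] {T : ℝ≥0∞}
    (hT : T ≠ ∞) {M : ℕ} {m m' : Fin M} (hne : m ≠ m') :
    ∫⁻ c, p.condLaw (c m) {y | (c m', y) ∈ p.passSet Q T} ∂(Measure.pi fun _ : Fin M => Q)
      ≤ T⁻¹ := by
  have hS := p.measurableSet_passSet Q T
  have h1 : ∀ c : Fin M → X, p.condLaw (c m) {y | (c m', y) ∈ p.passSet Q T} =
      ∫⁻ y, p.dens (c m) y * (p.passSet Q T).indicator 1 (c m', y) ∂ν := fun c =>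
    p.condLaw_section _ _ hS
  simp_rw [h1]
  have hmeas : Measurable (Function.uncurry fun (c : Fin M → X) (y : Y) =>
      (p.dens (c m) y : ℝ≥0∞) * (p.passSet Q T).indicator 1 (c m', y)) := by
    have e1 : Measurable fun z : (Fin M → X) × Y => (z.1 m, z.2) := by fun_prop
    have e2 : Measurable fun z : (Fin M → X) × Y => (z.1 m', z.2) := by fun_prop
    exact (p.measurable_dens_coe.comp e1).mul ((measurable_one.indicator hS).comp e2)
  rw [lintegral_lintegral_swap hmeas.aemeasurable, ENNReal.le_inv_iff_mul_le, mul_comm,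
    ← lintegral_const_mul' _ _ hT]
  calc _ ≤ ∫⁻ y, p.outDens Q y ∂ν := ?_
    _ = 1 := p.lintegral_outDens Q
  refine lintegral_mono fun y => ?_
  have hind : Measurable fun x : X => (p.passSet Q T).indicator (1 : X × Y → ℝ≥0∞) (x, y) :=
    (measurable_one.indicator hS).comp measurable_prodMk_right
  have h2 := lintegral_pi_mul_of_ne Q hne (p.measurable_dens_left y) hind
  simp only at h2 ⊢
  rw [h2]
  change T * (p.outDens Q y * _) ≤ _
  rw [← mul_assoc, ← lintegral_const_mul _ hind]
  -- By definition of passing, `T p_Q(y) 1{(x,y) passes} ≤ p(y|x)`; integrating over the independent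
  -- wrong word `x` leaves `p_Q(y)`.
  refine lintegral_mono fun x => ?_
  by_cases hx : (x, y) ∈ p.passSet Q T
  · simpa [hx] using le_of_lt hx
  · simp [hx]

/-- The right code word misses the threshold with probability bounded by a tilted integral. -/
theorem lintegral_condLaw_compl_passSet_le [SFinite ν] (Q : Measure X) [IsProbabilityMeasure Q] {T : ℝ≥0∞}
    (hT : T ≠ ∞) {M : ℕ} (m : Fin M) {l : ℝ} (hl0 : 0 ≤ l) (hl1 : l ≤ 1) :
    ∫⁻ c, p.condLaw (c m) {y | (c m, y) ∈ (p.passSet Q T)ᶜ} ∂(Measure.pi fun _ : Fin M => Q)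
      ≤ T ^ l * ∫⁻ x, ∫⁻ y, (p.dens x y : ℝ≥0∞) ^ (1 - l) * p.outDens Q y ^ l ∂ν ∂Q := by
  have hS := (p.measurableSet_passSet Q T).compl
  have hTl : T ^ l ≠ ∞ := ENNReal.rpow_ne_top_of_nonneg hl0 hT
  have hev := (measurePreserving_eval (fun _ : Fin M => Q) m).lintegral_comp
    (p.measurable_condLaw_section measurable_id hS)
  refine le_of_eq_of_le hev ?_
  rw [← lintegral_const_mul' _ _ hTl]
  refine lintegral_mono fun x => ?_
  rw [← lintegral_const_mul' _ _ hTl]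
  change p.condLaw x _ ≤ _
  rw [p.condLaw_section _ _ hS]
  refine lintegral_mono fun y => ?_
  by_cases hx : (x, y) ∈ p.passSet Q T
  · simp [hx]
  -- Failing the threshold means `p ≤ T p_Q`, so in `p = p^(1-l) p^l` the second factor is at most
  -- `(T p_Q)^l`.
  · have hle : (p.dens x y : ℝ≥0∞) ≤ T * p.outDens Q y := not_lt.1 hx
    have : (p.dens x y : ℝ≥0∞) =
        (p.dens x y : ℝ≥0∞) ^ (1 - l) * (p.dens x y : ℝ≥0∞) ^ l := by
      rw [← ENNReal.rpow_add_of_nonneg _ _ (by linarith) hl0, sub_add_cancel, ENNReal.rpow_one]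
    simp only [Set.indicator, Set.mem_compl_iff, hx, not_false_eq_true, if_true,
      Pi.one_apply, mul_one]
    calc (p.dens x y : ℝ≥0∞) = _ := this
      _ ≤ (p.dens x y : ℝ≥0∞) ^ (1 - l) * (T * p.outDens Q y) ^ l := by gcongr
      _ = _ := by
        rw [ENNReal.mul_rpow_of_nonneg _ _ hl0]
        ring

/-- The threshold decoder, with its union bound. -/
theorem exists_threshold_decoder (Q : Measure X) [SFinite Q] (T : ℝ≥0∞) {M : ℕ} (hM : 0 < M) :
    ∃ dec : (Fin M → X) → Y → Fin M, Measurable (Function.uncurry dec) ∧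
      ∀ (c : Fin M → X) (m : Fin M), p.condLaw (c m) {y | dec c y ≠ m} ≤
        p.condLaw (c m) {y | (c m, y) ∈ (p.passSet Q T)ᶜ} +
          ∑ m' ∈ Finset.univ.erase m, p.condLaw (c m) {y | (c m', y) ∈ p.passSet Q T} := by
  have hS := p.measurableSet_passSet Q T
  have hSm : ∀ m : Fin M, MeasurableSet {z : (Fin M → X) × Y | (z.1 m, z.2) ∈ p.passSet Q T} :=
    fun m => by
      have : Measurable fun z : (Fin M → X) × Y => (z.1 m, z.2) := by fun_prop
      exact this hS
  obtain ⟨g, hg, hgs⟩ := exists_measurable_selector _ hSm ⟨0, hM⟩ Finset.univ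
  refine ⟨fun c y => g (c, y), hg, fun c m => ?_⟩
  refine (measure_mono (t := {y | (c m, y) ∈ (p.passSet Q T)ᶜ} ∪
    ⋃ m' ∈ Finset.univ.erase m, {y | (c m', y) ∈ p.passSet Q T}) ?_).trans
    ((measure_union_le _ _).trans (add_le_add_right (measure_biUnion_finset_le _ _) _))
  intro y hy
  by_contra hcon
  rw [Set.mem_union, not_or, Set.mem_iUnion₂, not_exists] at hcon
  -- If the sent word passes and no other word does, the selector must return it; an error therefore
  -- lies in the union.
  refine hy (hgs (c, y) m (Finset.mem_univ m) (not_not.1 hcon.1) fun j _ hj hjS => ?_)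
  exact hcon.2 j ⟨Finset.mem_erase.2 ⟨hj, Finset.mem_univ j⟩, hjS⟩

theorem lintegral_sum_errors_le [SFinite ν] (Q : Measure X) [IsProbabilityMeasure Q] {T : ℝ≥0∞}
    (hT : T ≠ ∞) {M : ℕ} {l : ℝ} (hl0 : 0 ≤ l) (hl1 : l ≤ 1) :
    ∫⁻ c, ∑ m : Fin M, (p.condLaw (c m) {y | (c m, y) ∈ (p.passSet Q T)ᶜ} +
        ∑ m' ∈ Finset.univ.erase m, p.condLaw (c m) {y | (c m', y) ∈ p.passSet Q T})
          ∂(Measure.pi fun _ : Fin M => Q) ≤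
      M * (T ^ l * (∫⁻ x, ∫⁻ y, (p.dens x y : ℝ≥0∞) ^ (1 - l) * p.outDens Q y ^ l ∂ν ∂Q)
        + M / T) := by
  have hS := p.measurableSet_passSet Q T
  have hSm : ∀ m : Fin M, MeasurableSet {z : (Fin M → X) × Y | (z.1 m, z.2) ∈ p.passSet Q T} :=
    fun m => by
      have : Measurable fun z : (Fin M → X) × Y => (z.1 m, z.2) := by fun_prop
      exact this hS
  have hm1 : ∀ m : Fin M, Measurable fun c : Fin M → X =>
      p.condLaw (c m) {y | (c m, y) ∈ (p.passSet Q T)ᶜ} := fun m =>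
    p.measurable_condLaw_section (f := fun c : Fin M → X => c m) (measurable_pi_apply m)
      (S := {z : (Fin M → X) × Y | (z.1 m, z.2) ∈ p.passSet Q T}ᶜ) (hSm m).compl
  have hm2 : ∀ m m' : Fin M, Measurable fun c : Fin M → X =>
      p.condLaw (c m) {y | (c m', y) ∈ p.passSet Q T} := fun m m' =>
    p.measurable_condLaw_section (f := fun c : Fin M → X => c m) (measurable_pi_apply m)
      (S := {z : (Fin M → X) × Y | (z.1 m', z.2) ∈ p.passSet Q T}) (hSm m')
  have hm3 : ∀ m : Fin M, Measurable fun c : Fin M → X =>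
      p.condLaw (c m) {y | (c m, y) ∈ (p.passSet Q T)ᶜ} +
        ∑ m' ∈ Finset.univ.erase m, p.condLaw (c m) {y | (c m', y) ∈ p.passSet Q T} := fun m =>
    (hm1 m).add (Finset.measurable_sum _ fun m' _ => hm2 m m')
  rw [lintegral_finsetSum _ fun m _ => hm3 m]
  set A := T ^ l * ∫⁻ x, ∫⁻ y, (p.dens x y : ℝ≥0∞) ^ (1 - l) * p.outDens Q y ^ l ∂ν ∂Q with hA
  have hcard : (M : ℝ≥0∞) * (A + M / T) = (Finset.univ : Finset (Fin M)).card • (A + M / T) := by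
    rw [nsmul_eq_mul, Finset.card_univ, Fintype.card_fin]
  rw [hcard]
  refine Finset.sum_le_card_nsmul _ _ _ fun m _ => ?_
  rw [lintegral_add_left (hm1 m), lintegral_finsetSum _ fun m' _ => hm2 m m']
  refine add_le_add (p.lintegral_condLaw_compl_passSet_le Q hT m hl0 hl1) ?_
  refine (Finset.sum_le_card_nsmul _ _ T⁻¹ fun m' hm' =>
    p.lintegral_condLaw_passSet_le Q hT (Finset.ne_of_mem_erase hm').symm).trans ?_
  have hc : (Finset.univ.erase m).card ≤ M := by
    simpa only [Fintype.card_fin] using Finset.card_le_univ (Finset.univ.erase m)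
  rw [nsmul_eq_mul, div_eq_mul_inv]
  exact mul_le_mul_left (Nat.cast_le.2 hc) _

/-- One-shot random coding bound. -/
theorem exists_decoder [SFinite ν] (Q : Measure X) [IsProbabilityMeasure Q] {T : ℝ≥0∞}
    (hT : T ≠ ∞) {M : ℕ} (hM : 0 < M) {l : ℝ} (hl0 : 0 ≤ l) (hl1 : l ≤ 1) :
    ∃ dec : (Fin M → X) → Y → Fin M, Measurable (Function.uncurry dec) ∧
      ∫⁻ c, (∑ m, p.condLaw (c m) {y | dec c y ≠ m}) / M ∂(Measure.pi fun _ : Fin M => Q) ≤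
        T ^ l * (∫⁻ x, ∫⁻ y, (p.dens x y : ℝ≥0∞) ^ (1 - l) * p.outDens Q y ^ l ∂ν ∂Q) + M / T := by
  obtain ⟨dec, hdec, hle⟩ := p.exists_threshold_decoder Q T hM
  refine ⟨dec, hdec, ?_⟩
  simp only [div_eq_mul_inv _ (M : ℝ≥0∞)]
  rw [lintegral_mul_const' _ _ (by simpa using hM.ne'), ← div_eq_mul_inv]
  refine ENNReal.div_le_of_le_mul ?_
  rw [mul_comm]
  exact (lintegral_mono fun c => Finset.sum_le_sum fun m _ => hle c m).trans
    (p.lintegral_sum_errors_le Q hT hl0 hl1)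

/-- A single message is always decoded correctly; this serves as fallback where the rate is not yet
attained. -/
theorem isReliable_one (Q : Measure X) [IsProbabilityMeasure Q] (n : ℕ) (ε : ℝ) :
    IsReliable p Q n 1 ε := by
  have h : ∀ c : Fin 1 → Fin n → X, p.avgError c (fun _ => 0) = 0 := fun c => by
    simp [avgError]
  refine ⟨fun _ _ => 0, measurable_const, by simp [h], ?_⟩
  simp [h, codeEnsemble]

/-- The one-shot bound is applied to the block channel, where the tilted integral becomes an `n`-th
power. -/
theorem isReliable_of_le {ν : Measure Y} [SigmaFinite ν] (p : DensityChannel X Y ν)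
    (Q : Measure X) [IsProbabilityMeasure Q] {T : ℝ≥0∞}
    (hT : T ≠ ∞) {n M : ℕ} (hM : 0 < M) {l : ℝ} (hl0 : 0 ≤ l) (hl1 : l ≤ 1) {ε : ℝ}
    (h : T ^ l * (∫⁻ x, ∫⁻ y, (p.dens x y : ℝ≥0∞) ^ (1 - l) * p.outDens Q y ^ l ∂ν ∂Q) ^ n + M / T
      ≤ ENNReal.ofReal ε) :
    IsReliable p Q n M ε := by
  obtain ⟨dec, hdec, hle⟩ := (p.block n).exists_decoder (Measure.pi fun _ => Q) hT hM hl0 hl1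
  have hA : (∫⁻ x, ∫⁻ y, ((p.block n).dens x y : ℝ≥0∞) ^ (1 - l) *
      (p.block n).outDens (Measure.pi fun _ => Q) y ^ l ∂(Measure.pi fun _ => ν)
        ∂(Measure.pi fun _ => Q)) =
      (∫⁻ x, ∫⁻ y, (p.dens x y : ℝ≥0∞) ^ (1 - l) * p.outDens Q y ^ l ∂ν ∂Q) ^ n := by
    have e : ∀ (x : Fin n → X) (y : Fin n → Y), ((p.block n).dens x y : ℝ≥0∞) ^ (1 - l) *
        (p.block n).outDens (Measure.pi fun _ => Q) y ^ l =
        ∏ i, ((p.dens (x i) (y i) : ℝ≥0∞) ^ (1 - l) * p.outDens Q (y i) ^ l) := fun x y => by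
      rw [p.block_outDens, Finset.prod_mul_distrib, block, ENNReal.ofNNReal_finsetProd,
        ENNReal.prod_rpow_of_nonneg (by linarith), ENNReal.prod_rpow_of_nonneg hl0]
    have hm : Measurable fun z : X × Y =>
        (p.dens z.1 z.2 : ℝ≥0∞) ^ (1 - l) * p.outDens Q z.2 ^ l :=
      (p.measurable_dens_coe.pow_const _).mul
        (((p.measurable_outDens Q).comp measurable_snd).pow_const _)
    simp_rw [e]
    have e2 : ∀ x : Fin n → X, ∫⁻ y : Fin n → Y,
        ∏ i, ((p.dens (x i) (y i) : ℝ≥0∞) ^ (1 - l) * p.outDens Q (y i) ^ l)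
          ∂(Measure.pi fun _ => ν) =
        ∏ i, ∫⁻ y, (p.dens (x i) y : ℝ≥0∞) ^ (1 - l) * p.outDens Q y ^ l ∂ν := fun x =>
      lintegral_pi_prod_eq_prod_lintegral (fun _ => ν)
        (fun i y => (p.dens (x i) y : ℝ≥0∞) ^ (1 - l) * p.outDens Q y ^ l)
        fun i => hm.comp measurable_prodMk_left
    simp_rw [e2]
    rw [lintegral_pi_prod_eq_prod_lintegral (fun _ => Q)
      (fun _ x => ∫⁻ y, (p.dens x y : ℝ≥0∞) ^ (1 - l) * p.outDens Q y ^ l ∂ν)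
      fun _ => hm.lintegral_prod_right']
    simp
  rw [hA] at hle
  have havg : ∀ c : Fin M → Fin n → X, p.avgError c (dec c) =
      (∑ m, (p.block n).condLaw (c m) {y | dec c y ≠ m}) / M := fun c => by
    simp [avgError, p.block_condLaw]
  have hmeas : Measurable fun c : Fin M → Fin n → X => p.avgError c (dec c) := by
    simp_rw [havg]
    refine (Finset.measurable_sum _ fun m _ => ?_).div_const _
    exact (p.block n).measurable_condLaw_section (measurable_pi_apply m)
      (S := {z | dec z.1 z.2 ≠ m}) (hdec (measurableSet_singleton m).compl)
  have hbound : ∫⁻ c, p.avgError c (dec c) ∂(codeEnsemble Q n M) ≤ ENNReal.ofReal ε := by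
    simp_rw [havg]
    exact hle.trans h
  refine ⟨dec, hdec, hbound, ?_⟩
  have : IsProbabilityMeasure (codeEnsemble Q n M) := by
    unfold codeEnsemble
    infer_instance
  -- Under a probability measure a function is at most its mean with positive probability.
  refine (lt_of_lt_of_le (measure_le_lintegral_pos hmeas.aemeasurable)
    (measure_mono fun c hc => ?_)).ne'
  exact le_trans hc hbound

end DensityChannel

/-! ### Exchanging the reference output density -/

theorem ENNReal.rpow_mul_rpow_le_weighted {a b : ℝ≥0∞} (ha : a ≠ ∞) (hb : b ≠ ∞) {l : ℝ}
    (hl0 : 0 ≤ l) (hl1 : l ≤ 1) :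
    a ^ (1 - l) * b ^ l ≤ ENNReal.ofReal (1 - l) * a + ENNReal.ofReal l * b := by
  obtain ⟨x, hx, rfl⟩ : ∃ x : ℝ, 0 ≤ x ∧ a = ENNReal.ofReal x :=
    ⟨a.toReal, ENNReal.toReal_nonneg, (ENNReal.ofReal_toReal ha).symm⟩
  obtain ⟨y, hy, rfl⟩ : ∃ y : ℝ, 0 ≤ y ∧ b = ENNReal.ofReal y :=
    ⟨b.toReal, ENNReal.toReal_nonneg, (ENNReal.ofReal_toReal hb).symm⟩
  have hl : 0 ≤ 1 - l := by linarith
  rw [ENNReal.ofReal_rpow_of_nonneg hx hl, ENNReal.ofReal_rpow_of_nonneg hy hl0,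
    ← ENNReal.ofReal_mul (by positivity), ← ENNReal.ofReal_mul hl, ← ENNReal.ofReal_mul hl0,
    ← ENNReal.ofReal_add (by positivity) (by positivity)]
  exact ENNReal.ofReal_le_ofReal (Real.geom_mean_le_arith_mean2_weighted hl hl0 hx hy (by ring))

/-- The relation `l = m (1 - l)` makes the powers of `g` cancel and those of `f` add up to `1 - l`.
AM-GM then splits off `h f / g`, which integrates to one when `g` is the average of `f`. -/
theorem ENNReal.rpow_mul_rpow_change_of_reference {f g h : ℝ≥0∞} (hf0 : f ≠ 0) (hf : f ≠ ∞)
    (hg0 : g ≠ 0) (hg : g ≠ ∞) {l m : ℝ} (hl0 : 0 ≤ l) (hl1 : l < 1) (hm : l = m * (1 - l)) :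
    f ^ (1 - l) * h ^ l = (f ^ (1 - m) * g ^ m) ^ (1 - l) * (h * (f / g)) ^ l := by
  have h1 : (1 - m) * (1 - l) + l = 1 - l := by linarith
  rw [ENNReal.mul_rpow_of_nonneg _ _ (by linarith : 0 ≤ 1 - l), ENNReal.mul_rpow_of_nonneg _ _ hl0,
    ENNReal.div_rpow_of_nonneg _ _ hl0, ← ENNReal.rpow_mul, ← ENNReal.rpow_mul, ← hm]
  have hgl : g ^ l ≠ 0 := by simp [hg0, hg]
  have hgl' : g ^ l ≠ ∞ := ENNReal.rpow_ne_top_of_nonneg hl0 hg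
  calc f ^ (1 - l) * h ^ l = f ^ ((1 - m) * (1 - l)) * f ^ l * h ^ l := by
        rw [← ENNReal.rpow_add _ _ hf0 hf, h1]
    _ = f ^ ((1 - m) * (1 - l)) * f ^ l * h ^ l * (g ^ l * (g ^ l)⁻¹) := by
        rw [ENNReal.mul_inv_cancel hgl hgl', mul_one]
    _ = _ := by
        rw [div_eq_mul_inv]
        ring

namespace DensityChannel

variable {X Y : Type*} [MeasurableSpace X] [MeasurableSpace Y] {ν : Measure Y} [SigmaFinite ν]
  (p : DensityChannel X Y ν)

/-- The Hellinger-type integral of order `m` of the joint law against the product of its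
marginals. -/
noncomputable def hellingerIntegral (P : Measure X) (m : ℝ) : ℝ≥0∞ :=
  ∫⁻ x, ∫⁻ y, (p.dens x y : ℝ≥0∞) ^ (1 - m) * p.outDens P y ^ m ∂ν ∂P

theorem measurable_rpow_mul_rpow {ν : Measure Y} (p : DensityChannel X Y ν) (Q : Measure X)
    [SFinite Q] (m : ℝ) :
    Measurable fun z : X × Y => (p.dens z.1 z.2 : ℝ≥0∞) ^ (1 - m) * p.outDens Q z.2 ^ m :=
  (p.measurable_dens_coe.pow_const _).mul
    (((p.measurable_outDens Q).comp measurable_snd).pow_const _)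

/-- This removes the dependence on `Q`: for fixed `y` the average of `p(y|x) / p_P(y)` under `P` is
one, so the term containing `p_Q` contributes only its total mass. -/
theorem lintegral_rpow_mul_rpow_le (P Q : Measure X) [IsProbabilityMeasure P]
    [IsProbabilityMeasure Q] {l m : ℝ} (hl0 : 0 ≤ l) (hl1 : l < 1) (hm1 : m < 1)
    (hm : l = m * (1 - l)) :
    ∫⁻ x, ∫⁻ y, (p.dens x y : ℝ≥0∞) ^ (1 - l) * p.outDens Q y ^ l ∂ν ∂P ≤
      ENNReal.ofReal (1 - l) * p.hellingerIntegral P m + ENNReal.ofReal l := by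
  have hm0 : 0 ≤ m := by
    by_contra h
    nlinarith
  unfold hellingerIntegral
  have hl := lintegral_lintegral_swap (μ := P) (ν := ν)
    (f := fun x y => (p.dens x y : ℝ≥0∞) ^ (1 - l) * p.outDens Q y ^ l)
    (p.measurable_rpow_mul_rpow Q l).aemeasurable
  have hr := lintegral_lintegral_swap (μ := P) (ν := ν)
    (f := fun x y => (p.dens x y : ℝ≥0∞) ^ (1 - m) * p.outDens P y ^ m)
    (p.measurable_rpow_mul_rpow P m).aemeasurable
  rw [hl, hr]
  have hsum : ENNReal.ofReal l = ∫⁻ y, ENNReal.ofReal l * p.outDens Q y ∂ν := by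
    rw [lintegral_const_mul _ (p.measurable_outDens Q), p.lintegral_outDens, mul_one]
  rw [hsum]
  rw [← lintegral_const_mul' _ _ ENNReal.ofReal_ne_top,
    ← lintegral_add_right _ ((p.measurable_outDens Q).const_mul _)]
  refine lintegral_mono_ae ?_
  filter_upwards [p.ae_outDens_lt_top P, p.ae_outDens_lt_top Q] with y hg hh
  have hfm := p.measurable_dens_left y
  by_cases hg0 : p.outDens P y = 0
  -- Where the output density of `P` vanishes, `p(y|x) = 0` for `P`-almost every `x`, so the left
  -- side vanishes.
  · have h0 : ∫⁻ x, (p.dens x y : ℝ≥0∞) ^ (1 - l) * p.outDens Q y ^ l ∂P = 0 := by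
      rw [lintegral_eq_zero_iff ((hfm.pow_const _).mul_const _)]
      filter_upwards [(lintegral_eq_zero_iff hfm).1 hg0] with x hx
      have hx' : (p.dens x y : ℝ≥0∞) = 0 := hx
      simp only [hx', Pi.zero_apply]
      rw [ENNReal.zero_rpow_of_pos (by linarith), zero_mul]
    rw [h0]
    exact zero_le
  · calc ∫⁻ x, (p.dens x y : ℝ≥0∞) ^ (1 - l) * p.outDens Q y ^ l ∂P
        ≤ ∫⁻ x, (ENNReal.ofReal (1 - l) * ((p.dens x y : ℝ≥0∞) ^ (1 - m) * p.outDens P y ^ m) +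
          ENNReal.ofReal l * (p.outDens Q y * (p.dens x y / p.outDens P y))) ∂P := by
          refine lintegral_mono fun x => ?_
          by_cases hf0 : (p.dens x y : ℝ≥0∞) = 0
          · simp only [hf0]
            rw [ENNReal.zero_rpow_of_pos (by linarith), zero_mul]
            exact zero_le
          · simp only
            rw [ENNReal.rpow_mul_rpow_change_of_reference hf0 ENNReal.coe_ne_top hg0 hg.ne hl0 hl1 hm]
            refine ENNReal.rpow_mul_rpow_le_weighted ?_ ?_ hl0 hl1.le
            · exact ENNReal.mul_ne_top
                (ENNReal.rpow_ne_top_of_nonneg (by linarith) ENNReal.coe_ne_top)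
                (ENNReal.rpow_ne_top_of_nonneg hm0 hg.ne)
            · exact ENNReal.mul_ne_top hh.ne (ENNReal.div_ne_top ENNReal.coe_ne_top hg0)
      _ = _ := by
          have e : ∫⁻ x, (p.dens x y : ℝ≥0∞) / p.outDens P y ∂P = 1 := by
            simp only [div_eq_mul_inv]
            rw [lintegral_mul_const _ hfm]
            exact ENNReal.mul_inv_cancel hg0 hg.ne
          rw [lintegral_add_right _ (((hfm.div_const _).const_mul _).const_mul _),
            lintegral_const_mul' _ _ ENNReal.ofReal_ne_top,
            lintegral_const_mul' _ _ ENNReal.ofReal_ne_top, lintegral_const_mul' _ _ hh.ne, e,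
            mul_one]

theorem hellingerIntegral_sparseLaw_le (x₀ : X) (P : Measure X) [IsProbabilityMeasure P]
    {τ : ℝ≥0∞} (hτ : τ ≤ 1) {l m : ℝ} (hl0 : 0 ≤ l) (hl1 : l < 1) (hm1 : m < 1)
    (hm : l = m * (1 - l)) :
    p.hellingerIntegral (sparseLaw x₀ P τ) l ≤
      (1 - τ) + τ * (ENNReal.ofReal (1 - l) * p.hellingerIntegral P m + ENNReal.ofReal l) := by
  have := isProbabilityMeasure_sparseLaw x₀ P hτ
  set Q := sparseLaw x₀ P τ with hQ
  have hmQ := (p.measurable_rpow_mul_rpow Q l).lintegral_prod_right' (ν := ν)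
  unfold hellingerIntegral
  nth_rewrite 1 [hQ]
  rw [sparseLaw, lintegral_add_measure, lintegral_smul_measure, lintegral_smul_measure,
    smul_eq_mul, smul_eq_mul, lintegral_dirac' _ hmQ]
  -- For the innocent symbol AM-GM gives the bound `1`; the whole gain comes from the `τ` part.
  refine add_le_add (mul_le_of_le_one_right' ?_) ?_
  · calc ∫⁻ y, (p.dens x₀ y : ℝ≥0∞) ^ (1 - l) * p.outDens Q y ^ l ∂ν
        ≤ ∫⁻ y, (ENNReal.ofReal (1 - l) * p.dens x₀ y + ENNReal.ofReal l * p.outDens Q y) ∂ν := by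
          refine lintegral_mono_ae ?_
          filter_upwards [p.ae_outDens_lt_top Q] with y hy
          exact ENNReal.rpow_mul_rpow_le_weighted ENNReal.coe_ne_top hy.ne hl0 hl1.le
      _ = 1 := by
          rw [lintegral_add_right _ ((p.measurable_outDens Q).const_mul _),
            lintegral_const_mul' _ _ ENNReal.ofReal_ne_top,
            lintegral_const_mul' _ _ ENNReal.ofReal_ne_top, p.lintegral_dens, p.lintegral_outDens,
            mul_one, mul_one, ← ENNReal.ofReal_add (by linarith) hl0]
          simp
  · gcongr
    exact p.lintegral_rpow_mul_rpow_le P Q hl0 hl1 hm1 hm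

end DensityChannel

/-! ### Approximating mutual information by divergences of order `m` -/

/-- The divergence generator of order `m`, which tends to `klFun` as `m → 0`. -/
noncomputable def tiltFun (m r : ℝ) : ℝ := (r - r ^ (1 - m)) / m + 1 - r

theorem measurable_tiltFun (m : ℝ) : Measurable (tiltFun m) := by
  unfold tiltFun
  fun_prop

/-- This is weighted AM-GM for `r` and `1`. The summand `1 - r` secures pointwise nonnegativity, so
that Fatou's lemma applies. -/
theorem tiltFun_nonneg {m r : ℝ} (hm0 : 0 < m) (hm1 : m < 1) (hr : 0 ≤ r) : 0 ≤ tiltFun m r := by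
  have h := Real.geom_mean_le_arith_mean2_weighted (by linarith : 0 ≤ 1 - m) hm0.le hr zero_le_one
    (by ring)
  rw [Real.one_rpow, mul_one, mul_one] at h
  have : tiltFun m r = ((1 - m) * r + m - r ^ (1 - m)) / m := by
    rw [tiltFun]
    field_simp
    ring
  rw [this]
  exact div_nonneg (by linarith) hm0.le

theorem mul_tiltFun_add {m : ℝ} (hm0 : 0 < m) (r : ℝ) :
    m * tiltFun m r + r ^ (1 - m) = (1 - m) * r + m := by
  rw [tiltFun]
  field_simp
  ring

theorem tendsto_tiltFun {r : ℝ} (hr : 0 ≤ r) :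
    Tendsto (fun m => tiltFun m r) (𝓝[>] 0) (𝓝 (klFun r)) := by
  have hkl : klFun r = r * Real.log r + 1 - r := rfl
  rw [hkl]
  refine Tendsto.sub_const (Tendsto.add_const 1 ?_) r
  rcases hr.eq_or_lt with rfl | hr
  · refine (tendsto_const_nhds (x := (0 : ℝ))).congr' ?_ |>.trans (by simp)
    have : ∀ᶠ m : ℝ in 𝓝[>] 0, m < 1 := nhdsWithin_le_nhds (gt_mem_nhds one_pos)
    filter_upwards [this] with m hm
    rw [Real.zero_rpow (by linarith)]
    simp
  -- The quotient in `tiltFun` is the difference quotient at `0` of `m ↦ -r ^ (1 - m)`.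
  · have hd : HasDerivAt (fun m : ℝ => -r ^ (1 - m)) (r * Real.log r) 0 := by
      have h := (((hasDerivAt_id (0 : ℝ)).const_sub 1).const_rpow hr).neg
      simpa [mul_comm, Pi.neg_def] using h
    have hs := hd.tendsto_slope_zero_right
    refine hs.congr' (Eventually.of_forall fun m => ?_)
    simp only [zero_add, sub_zero, Real.rpow_one, smul_eq_mul]
    ring

namespace DensityChannel

variable {X Y : Type*} [MeasurableSpace X] [MeasurableSpace Y] {ν : Measure Y} [SigmaFinite ν]
  (p : DensityChannel X Y ν) (P : Measure X) [IsProbabilityMeasure P]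

theorem prod_outLaw : P.prod (p.outLaw P) =
    (P.prod ν).withDensity fun z => p.outDens P z.2 :=
  prod_withDensity_right (p.measurable_outDens P)

theorem measurable_ratio {ν : Measure Y} (p : DensityChannel X Y ν) (P : Measure X) [SFinite P] :
    Measurable fun z : X × Y => (p.dens z.1 z.2 : ℝ≥0∞) / p.outDens P z.2 :=
  p.measurable_dens_coe.div ((p.measurable_outDens P).comp measurable_snd)

theorem ae_outDens_snd_lt_top : ∀ᵐ z ∂(P.prod ν), p.outDens P z.2 < ∞ :=
  Measure.quasiMeasurePreserving_snd.ae (p.ae_outDens_lt_top P)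

theorem ae_dens_eq_zero_of_outDens_eq_zero :
    ∀ᵐ z ∂(P.prod ν), p.outDens P z.2 = 0 → (p.dens z.1 z.2 : ℝ≥0∞) = 0 := by
  have hi : Measurable (({0} : Set ℝ≥0∞).indicator (1 : ℝ≥0∞ → ℝ≥0∞)) :=
    measurable_one.indicator (measurableSet_singleton 0)
  have hm : Measurable fun z : X × Y =>
      ({0} : Set ℝ≥0∞).indicator (1 : ℝ≥0∞ → ℝ≥0∞) (p.outDens P z.2) * p.dens z.1 z.2 :=
    (hi.comp ((p.measurable_outDens P).comp measurable_snd)).mul p.measurable_dens_coe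
  have h0 : ∫⁻ z, ({0} : Set ℝ≥0∞).indicator (1 : ℝ≥0∞ → ℝ≥0∞) (p.outDens P z.2) *
      p.dens z.1 z.2 ∂(P.prod ν) = 0 := by
    -- Integrating over `x` first turns the density into `p_P(y)`, which is zero on the indicated
    -- set.
    rw [lintegral_prod_symm _ hm.aemeasurable]
    refine (lintegral_congr fun y => ?_).trans lintegral_zero
    simp only
    rw [lintegral_const_mul _ (p.measurable_dens_left y)]
    change _ * p.outDens P y = 0
    by_cases h : p.outDens P y = 0 <;> simp [h]
  filter_upwards [(lintegral_eq_zero_iff hm).1 h0] with z hz hz0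
  simpa [hz0] using hz

theorem jointLaw_eq_withDensity :
    p.jointLaw P = (P.prod (p.outLaw P)).withDensity
      fun z => (p.dens z.1 z.2 : ℝ≥0∞) / p.outDens P z.2 := by
  have hg : Measurable fun z : X × Y => p.outDens P z.2 :=
    (p.measurable_outDens P).comp measurable_snd
  rw [p.prod_outLaw, ← withDensity_mul _ hg (p.measurable_ratio P), jointLaw]
  refine withDensity_congr_ae ?_
  filter_upwards [p.ae_outDens_snd_lt_top P, p.ae_dens_eq_zero_of_outDens_eq_zero P] with z h1 h2
  by_cases h0 : p.outDens P z.2 = 0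
  · simp [h2 h0]
  · exact (ENNReal.mul_div_cancel h0 h1.ne).symm

instance isProbabilityMeasure_jointLaw : IsProbabilityMeasure (p.jointLaw P) := ⟨by
  rw [jointLaw, withDensity_apply _ .univ, setLIntegral_univ,
    lintegral_prod _ p.measurable_dens_coe.aemeasurable]
  simp [p.lintegral_dens]⟩

theorem lintegral_ratio : ∫⁻ z, (p.dens z.1 z.2 : ℝ≥0∞) / p.outDens P z.2 ∂(P.prod (p.outLaw P))
    = 1 := by
  rw [← setLIntegral_univ, ← withDensity_apply _ .univ, ← jointLaw_eq_withDensity, measure_univ]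

theorem mutualInfo_eq_lintegral :
    p.mutualInfo P = ∫⁻ z, ENNReal.ofReal
      (klFun ((p.dens z.1 z.2 : ℝ≥0∞) / p.outDens P z.2).toReal) ∂(P.prod (p.outLaw P)) := by
  have hac : p.jointLaw P ≪ P.prod (p.outLaw P) := by
    rw [jointLaw_eq_withDensity]
    exact withDensity_absolutelyContinuous _ _
  rw [mutualInfo, klDiv_eq_lintegral_klFun_of_ac hac]
  refine lintegral_congr_ae ?_
  have h := Measure.rnDeriv_withDensity (P.prod (p.outLaw P)) (p.measurable_ratio P)
  rw [← jointLaw_eq_withDensity] at h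
  filter_upwards [h] with z hz
  rw [hz]

/-- The integral of `tiltFun m` of the likelihood ratio. -/
noncomputable def tiltDiv (m : ℝ) : ℝ≥0∞ :=
  ∫⁻ z, ENNReal.ofReal (tiltFun m ((p.dens z.1 z.2 : ℝ≥0∞) / p.outDens P z.2).toReal)
    ∂(P.prod (p.outLaw P))

theorem hellingerIntegral_eq_lintegral_ratio {m : ℝ} (hm0 : 0 < m) (hm1 : m < 1) :
    p.hellingerIntegral P m =
      ∫⁻ z, ((p.dens z.1 z.2 : ℝ≥0∞) / p.outDens P z.2) ^ (1 - m) ∂(P.prod (p.outLaw P)) := by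
  have hg : Measurable fun z : X × Y => p.outDens P z.2 :=
    (p.measurable_outDens P).comp measurable_snd
  rw [p.prod_outLaw, lintegral_withDensity_eq_lintegral_mul _ hg
    ((p.measurable_ratio P).pow_const _), hellingerIntegral,
    ← lintegral_prod _ (p.measurable_rpow_mul_rpow P m).aemeasurable]
  refine lintegral_congr_ae ?_
  filter_upwards [p.ae_outDens_snd_lt_top P, p.ae_dens_eq_zero_of_outDens_eq_zero P] with z h1 h2
  have hm : 0 ≤ 1 - m := by linarith
  simp only [Pi.mul_apply]
  by_cases h0 : p.outDens P z.2 = 0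
  · rw [h2 h0, h0, ENNReal.zero_rpow_of_pos hm0, mul_zero, zero_mul]
  · have hr0 : p.outDens P z.2 ^ (1 - m) ≠ 0 := by simp [h0, h1.ne]
    have hrt : p.outDens P z.2 ^ (1 - m) ≠ ∞ := ENNReal.rpow_ne_top_of_nonneg hm h1.ne
    have hs : p.outDens P z.2 = p.outDens P z.2 ^ m * p.outDens P z.2 ^ (1 - m) := by
      rw [← ENNReal.rpow_add _ _ h0 h1.ne, add_sub_cancel, ENNReal.rpow_one]
    rw [ENNReal.div_rpow_of_nonneg _ _ hm]
    nth_rewrite 2 [hs]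
    rw [mul_assoc, ENNReal.mul_div_cancel hr0 hrt, mul_comm]

theorem ae_ratio_lt_top : ∀ᵐ z ∂(P.prod (p.outLaw P)),
    (p.dens z.1 z.2 : ℝ≥0∞) / p.outDens P z.2 < ∞ :=
  ae_lt_top (p.measurable_ratio P) (by simp [p.lintegral_ratio P])

/-- Integrating `mul_tiltFun_add` against the product law, where the ratio has mean one. As a sum
equal to `1`, it also shows that `tiltDiv` is finite even if the mutual information is not. -/
theorem ofReal_mul_tiltDiv_add_hellingerIntegral {m : ℝ} (hm0 : 0 < m) (hm1 : m < 1) :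
    ENNReal.ofReal m * p.tiltDiv P m + p.hellingerIntegral P m = 1 := by
  rw [p.hellingerIntegral_eq_lintegral_ratio P hm0 hm1, tiltDiv,
    ← lintegral_const_mul' _ _ ENNReal.ofReal_ne_top,
    ← lintegral_add_right _ ((p.measurable_ratio P).pow_const _)]
  calc _ = ∫⁻ z, (ENNReal.ofReal (1 - m) * ((p.dens z.1 z.2 : ℝ≥0∞) / p.outDens P z.2)
        + ENNReal.ofReal m) ∂(P.prod (p.outLaw P)) := by
        refine lintegral_congr_ae ?_
        filter_upwards [p.ae_ratio_lt_top P] with z hz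
        have hr : 0 ≤ ((p.dens z.1 z.2 : ℝ≥0∞) / p.outDens P z.2).toReal := ENNReal.toReal_nonneg
        have hm : 0 ≤ 1 - m := by linarith
        nth_rewrite 2 [← ENNReal.ofReal_toReal hz.ne]
        nth_rewrite 3 [← ENNReal.ofReal_toReal hz.ne]
        rw [ENNReal.ofReal_rpow_of_nonneg hr hm, ← ENNReal.ofReal_mul hm0.le,
          ← ENNReal.ofReal_mul hm, ← ENNReal.ofReal_add
            (mul_nonneg hm0.le (tiltFun_nonneg hm0 hm1 hr)) (by positivity),
          ← ENNReal.ofReal_add (by positivity) hm0.le, mul_tiltFun_add hm0]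
    _ = 1 := by
        rw [lintegral_add_left ((p.measurable_ratio P).const_mul _),
          lintegral_const_mul' _ _ ENNReal.ofReal_ne_top, p.lintegral_ratio P, lintegral_const,
          measure_univ, mul_one, mul_one, ← ENNReal.ofReal_add (by linarith) hm0.le]
        simp

theorem exists_lt_tiltDiv {K : ℝ≥0∞} (hK : K < p.mutualInfo P) :
    ∃ m : ℝ, 0 < m ∧ m < 1 ∧ K < p.tiltDiv P m := by
  have hle : p.mutualInfo P ≤ liminf (fun m => p.tiltDiv P m) (𝓝[>] 0) := by
    rw [p.mutualInfo_eq_lintegral P]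
    calc _ = ∫⁻ z, liminf (fun m => ENNReal.ofReal
          (tiltFun m ((p.dens z.1 z.2 : ℝ≥0∞) / p.outDens P z.2).toReal)) (𝓝[>] 0)
            ∂(P.prod (p.outLaw P)) := by
          refine lintegral_congr fun z => ?_
          exact (ENNReal.tendsto_ofReal (tendsto_tiltFun ENNReal.toReal_nonneg)).liminf_eq.symm
      -- Fatou gives the lower bound that is needed; convergence of `tiltDiv` is not required.
      _ ≤ _ := lintegral_liminf_le fun m =>
          ((measurable_tiltFun m).comp (p.measurable_ratio P).ennreal_toReal).ennreal_ofReal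
  have h1 := eventually_lt_of_lt_liminf (hK.trans_le hle)
  have h2 : ∀ᶠ m : ℝ in 𝓝[>] 0, 0 < m := eventually_mem_nhdsWithin
  have h3 : ∀ᶠ m : ℝ in 𝓝[>] 0, m < 1 := nhdsWithin_le_nhds (gt_mem_nhds one_pos)
  obtain ⟨m, h, h', h''⟩ := (h1.and (h2.and h3)).exists
  exact ⟨m, h', h'', h⟩

end DensityChannel

/-! ### Square-root asymptotics and the limit -/

theorem exists_tendsto_atTop_eventually_diagonal {p : ℕ → ℕ → Prop}
    (h : ∀ k, ∀ᶠ n in atTop, p k n) :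
    ∃ k : ℕ → ℕ, Tendsto k atTop atTop ∧ ∀ᶠ n in atTop, p (k n) n := by
  choose N hN using fun k => eventually_atTop.1 (h k)
  -- The largest admissible `k ≤ n`; the cap makes the maximum exist, and `k = 0` is admissible once
  -- `n ≥ N 0`.
  refine ⟨fun n => Nat.findGreatest (fun k => N k ≤ n) n, tendsto_atTop.2 fun K => ?_, ?_⟩
  · filter_upwards [eventually_ge_atTop K, eventually_ge_atTop (N K)] with n h1 h2
    exact Nat.le_findGreatest h1 h2
  · filter_upwards [eventually_ge_atTop (N 0)] with n hn
    exact hN _ _ (Nat.findGreatest_spec (P := fun k => N k ≤ n) (Nat.zero_le n) hn)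

theorem xiConst_pos (ε : ℝ) : 0 < xiConst ε := Real.exp_pos _

theorem eventually_div_sqrt_le_sparseness {ε : ℝ} {χ2 : ℝ≥0∞} {c : ℝ}
    (h : ENNReal.ofReal c < ENNReal.ofReal (2 * xiConst ε * ε) / χ2 ^ (1 / 2 : ℝ)) :
    ∀ᶠ n : ℕ in atTop, ENNReal.ofReal (c / √(n : ℝ)) ≤ sparseness ε χ2 n := by
  have hs : Tendsto (fun n : ℕ => √(n : ℝ)) atTop atTop :=
    Real.tendsto_sqrt_atTop.comp tendsto_natCast_atTop_atTop
  -- Once `√n ≥ c`, the cap `1` in the sparseness is harmless.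
  filter_upwards [hs.eventually_ge_atTop c, eventually_gt_atTop 0] with n hc hn
  have hn' : (0 : ℝ) < n := by exact_mod_cast hn
  have hsq : 0 < √(n : ℝ) := Real.sqrt_pos.2 hn'
  refine le_min ?_ ?_
  · rw [← ENNReal.ofReal_one]
    exact ENNReal.ofReal_le_ofReal ((div_le_one hsq).2 hc)
  · have e : (n : ℝ≥0∞) ^ (1 / 2 : ℝ) = ENNReal.ofReal √(n : ℝ) := by
      rw [Real.sqrt_eq_rpow, ← ENNReal.ofReal_rpow_of_nonneg hn'.le (by norm_num),
        ENNReal.ofReal_natCast]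
    have h0 : ENNReal.ofReal √(n : ℝ) ≠ 0 := by simpa using hn
    rw [ENNReal.mul_rpow_of_nonneg _ _ (by norm_num), e, ENNReal.ofReal_div_of_pos hsq,
      div_eq_mul_inv _ (_ * _), ENNReal.mul_inv (Or.inl h0) (Or.inl ENNReal.ofReal_ne_top),
      mul_comm (ENNReal.ofReal √(n : ℝ))⁻¹, ← mul_assoc, ← div_eq_mul_inv, ← div_eq_mul_inv]
    exact ENNReal.div_le_div_right h.le _

theorem natCeil_exp_le {x : ℝ} (hx : 0 ≤ x) : (⌈Real.exp x⌉₊ : ℝ) ≤ 2 * Real.exp x := by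
  have h1 := (Nat.ceil_lt_add_one (Real.exp_pos x).le).le
  have h2 := Real.one_le_exp hx
  linarith

theorem tendsto_exp_neg_mul_sqrt {a : ℝ} (ha : 0 < a) :
    Tendsto (fun n : ℕ => Real.exp (-(a * √(n : ℝ)))) atTop (𝓝 0) := by
  have hs : Tendsto (fun n : ℕ => √(n : ℝ)) atTop atTop :=
    Real.tendsto_sqrt_atTop.comp tendsto_natCast_atTop_atTop
  exact Real.tendsto_exp_neg_atTop_nhds_zero.comp (hs.const_mul_atTop ha)

namespace DensityChannel

variable {X Y : Type*} [MeasurableSpace X] [MeasurableSpace Y] {ν : Measure Y} [SigmaFinite ν]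
  (p : DensityChannel X Y ν) (x₀ : X) (P : Measure X) [IsProbabilityMeasure P]

theorem hellingerIntegral_sparseLaw_le_exp {τ : ℝ≥0∞} (hτ : τ ≤ 1) {m j t : ℝ} (hm0 : 0 < m)
    (hm1 : m < 1) (hj0 : 0 ≤ j) (hj : p.tiltDiv P m = ENNReal.ofReal j)
    (ht : ENNReal.ofReal t ≤ τ) :
    p.hellingerIntegral (sparseLaw x₀ P τ) (m / (1 + m)) ≤
      ENNReal.ofReal (Real.exp (-(t * (m / (1 + m)) * j))) := by
  have hm' : 0 < 1 + m := by linarith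
  set l := m / (1 + m) with hl
  have hl1 : 1 - l = 1 / (1 + m) := by
    rw [hl]
    field_simp
    ring
  have hl0 : 0 < l := by positivity
  have hl1' : 0 < 1 - l := by rw [hl1]; positivity
  have hml : l = m * (1 - l) := by
    rw [hl1, hl]
    ring
  obtain ⟨s, hs0, hs1, rfl⟩ : ∃ s : ℝ, 0 ≤ s ∧ s ≤ 1 ∧ τ = ENNReal.ofReal s :=
    ⟨τ.toReal, ENNReal.toReal_nonneg, ENNReal.toReal_le_of_le_ofReal zero_le_one (by simpa using hτ),
      (ENNReal.ofReal_toReal (ne_top_of_le_ne_top ENNReal.one_ne_top hτ)).symm⟩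
  have hts : t ≤ s := (ENNReal.ofReal_le_ofReal_iff hs0).1 ht
  have hE := p.ofReal_mul_tiltDiv_add_hellingerIntegral P hm0 hm1
  rw [hj, ← ENNReal.ofReal_mul hm0.le] at hE
  have hEt : p.hellingerIntegral P m ≠ ∞ := by
    intro h
    simp [h] at hE
  obtain ⟨e, he0, he⟩ : ∃ e : ℝ, 0 ≤ e ∧ p.hellingerIntegral P m = ENNReal.ofReal e :=
    ⟨_, ENNReal.toReal_nonneg, (ENNReal.ofReal_toReal hEt).symm⟩
  rw [he, ← ENNReal.ofReal_add (by positivity) he0, ENNReal.ofReal_eq_one] at hE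
  refine (p.hellingerIntegral_sparseLaw_le x₀ P hτ hl0.le (by linarith) hm1 hml).trans ?_
  rw [he, ← ENNReal.ofReal_mul hl1'.le, ← ENNReal.ofReal_add (by positivity) hl0.le,
    ← ENNReal.ofReal_mul hs0, ← ENNReal.ofReal_one, ← ENNReal.ofReal_sub _ hs0,
    ← ENNReal.ofReal_add (by linarith) (by positivity)]
  refine ENNReal.ofReal_le_ofReal ?_
  -- With `e = 1 - m j` the gain is `s (1 - l) m j`, and `m (1 - l) = l`.
  have h1 : 1 - s + s * ((1 - l) * e + l) = 1 - s * l * j := by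
    have : e = 1 - m * j := by linarith
    rw [this]
    linear_combination s * j * hml
  have h2 := Real.add_one_le_exp (-(t * l * j))
  have h3 : t * l * j ≤ s * l * j := by gcongr
  linarith

theorem eventually_isReliable {εdet εdec : ℝ} (hdec : 0 < εdec) {χ2 : ℝ≥0∞} {R : ℝ} (hR0 : 0 ≤ R)
    (hR : ENNReal.ofReal R <
      ENNReal.ofReal (2 * xiConst εdet * εdet) / χ2 ^ (1 / 2 : ℝ) * p.mutualInfo P) :
    ∀ᶠ n : ℕ in atTop, IsReliable p (sparseLaw x₀ P (sparseness εdet χ2 n)) n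
      ⌈Real.exp (R * √(n : ℝ))⌉₊ εdec := by
  set c := ENNReal.ofReal (2 * xiConst εdet * εdet) / χ2 ^ (1 / 2 : ℝ) with hc
  have hc0 : c ≠ 0 := by
    rintro h
    simp [h] at hR
  have hI := (ENNReal.div_lt_iff (Or.inl hc0) (Or.inr ENNReal.ofReal_ne_top)).2
    (by rwa [mul_comm] at hR)
  obtain ⟨m, hm0, hm1, hJ⟩ := p.exists_lt_tiltDiv P hI
  have hJt : p.tiltDiv P m ≠ ∞ := by
    intro h
    have := p.ofReal_mul_tiltDiv_add_hellingerIntegral P hm0 hm1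
    rw [h, ENNReal.mul_top (by simpa using hm0)] at this
    simp at this
  have hJ0 : p.tiltDiv P m ≠ 0 := (bot_le.trans_lt hJ).ne'
  have hRc : ENNReal.ofReal R / p.tiltDiv P m < c := by
    rw [ENNReal.div_lt_iff (Or.inl hJ0) (Or.inl hJt), mul_comm]
    exact (ENNReal.div_lt_iff (Or.inl hc0) (Or.inr ENNReal.ofReal_ne_top)).1 hJ
  obtain ⟨j, hj0, hj⟩ : ∃ j : ℝ, 0 < j ∧ p.tiltDiv P m = ENNReal.ofReal j :=
    ⟨_, ENNReal.toReal_pos hJ0 hJt, (ENNReal.ofReal_toReal hJt).symm⟩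
  -- `c` is infinite when `χ2 = 0`; a finite `c'` below it, still with `R < c' j`, is enough.
  obtain ⟨c', hc'0, hc1, hc2⟩ := ENNReal.lt_iff_exists_real_btwn.1 hRc
  have hRc' : R < c' * j := by
    rw [hj, ← ENNReal.ofReal_div_of_pos hj0] at hc1
    exact (div_lt_iff₀ hj0).1 ((ENNReal.ofReal_lt_ofReal_iff_of_nonneg (by positivity)).1 hc1)
  obtain ⟨R', hRR', hR'c⟩ := exists_between hRc'
  set l := m / (1 + m) with hl
  have hl0 : 0 < l := by positivity
  have hl1 : l ≤ 1 := by
    rw [hl, div_le_one (by positivity)]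
    linarith
  have hlim : Tendsto (fun n : ℕ => Real.exp (-(l * (c' * j - R') * √(n : ℝ))) +
      2 * Real.exp (-((R' - R) * √(n : ℝ)))) atTop (𝓝 0) := by
    have h1 := tendsto_exp_neg_mul_sqrt (a := l * (c' * j - R')) (mul_pos hl0 (by linarith))
    have h2 := tendsto_exp_neg_mul_sqrt (a := R' - R) (by linarith)
    simpa using h1.add (h2.const_mul 2)
  filter_upwards [hlim.eventually_le_const hdec, eventually_div_sqrt_le_sparseness hc2,
    eventually_gt_atTop 0] with n hn ht hn0
  have hτ := sparseness_le_one εdet χ2 n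
  have := isProbabilityMeasure_sparseLaw x₀ P hτ
  have hsq : 0 < √(n : ℝ) := Real.sqrt_pos.2 (by exact_mod_cast hn0)
  -- `R'` lies strictly between `R` and `c' j`: the first gap kills `M / T`, the second kills `T^l
  -- H^n`.
  refine p.isReliable_of_le _ (T := ENNReal.ofReal (Real.exp (R' * √(n : ℝ))))
    ENNReal.ofReal_ne_top (Nat.ceil_pos.2 (Real.exp_pos _)) hl0.le hl1 ?_
  refine le_trans (add_le_add ?_ ?_) ((ENNReal.ofReal_add (by positivity) (by positivity)).symm.trans_le
    (ENNReal.ofReal_le_ofReal hn))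
  · refine (mul_le_mul_right (pow_le_pow_left₀ zero_le
      (p.hellingerIntegral_sparseLaw_le_exp x₀ P hτ hm0 hm1 hj0.le hj ht) n) _).trans_eq ?_
    rw [ENNReal.ofReal_rpow_of_pos (Real.exp_pos _), ← Real.exp_mul,
      ← ENNReal.ofReal_pow (Real.exp_pos _).le, ← Real.exp_nat_mul,
      ← ENNReal.ofReal_mul (Real.exp_pos _).le, ← Real.exp_add]
    congr 2
    have hns : (n : ℝ) = √(n : ℝ) * √(n : ℝ) := (Real.mul_self_sqrt (Nat.cast_nonneg n)).symm
    rw [← hl]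
    nth_rewrite 2 [hns]
    field_simp
    ring
  · rw [← ENNReal.ofReal_natCast, ← ENNReal.ofReal_div_of_pos (Real.exp_pos _)]
    refine ENNReal.ofReal_le_ofReal ?_
    rw [div_le_iff₀ (Real.exp_pos _), mul_assoc, ← Real.exp_add]
    refine (natCeil_exp_le (by positivity)).trans_eq ?_
    congr 2
    ring

end DensityChannel

/-- Rounding up at most doubles `exp (u n √n)`, which costs `log 2 / √n`. -/
theorem tendsto_log_natCeil_exp_div_sqrt {u : ℕ → ℝ} (hu : ∀ n, 0 ≤ u n) {L : ℝ≥0∞}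
    (hL : Tendsto (fun n => ENNReal.ofReal (u n)) atTop (𝓝 L)) :
    Tendsto (fun n : ℕ => ENNReal.ofReal (Real.log ⌈Real.exp (u n * √(n : ℝ))⌉₊ / √(n : ℝ)))
      atTop (𝓝 L) := by
  have hs : Tendsto (fun n : ℕ => √(n : ℝ)) atTop atTop :=
    Real.tendsto_sqrt_atTop.comp tendsto_natCast_atTop_atTop
  have h2 : Tendsto (fun n : ℕ => ENNReal.ofReal (u n) + ENNReal.ofReal (Real.log 2 / √(n : ℝ)))
      atTop (𝓝 L) := by
    have h := ENNReal.tendsto_ofReal (hs.const_div_atTop (Real.log 2))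
    simpa using hL.add h
  refine tendsto_of_tendsto_of_tendsto_of_le_of_le' hL h2 ?_ ?_
  · filter_upwards [eventually_gt_atTop 0] with n hn
    have hsq : 0 < √(n : ℝ) := Real.sqrt_pos.2 (by exact_mod_cast hn)
    refine ENNReal.ofReal_le_ofReal ((le_div_iff₀ hsq).2 ?_)
    rw [Real.le_log_iff_exp_le (by exact_mod_cast Nat.ceil_pos.2 (Real.exp_pos _))]
    exact Nat.le_ceil _
  · filter_upwards [eventually_gt_atTop 0] with n hn
    have hsq : 0 < √(n : ℝ) := Real.sqrt_pos.2 (by exact_mod_cast hn)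
    have hlog : 0 ≤ Real.log 2 := Real.log_nonneg (by norm_num)
    rw [← ENNReal.ofReal_add (hu n) (by positivity)]
    refine ENNReal.ofReal_le_ofReal ((div_le_iff₀ hsq).2 ?_)
    have h0 : (0 : ℝ) < ⌈Real.exp (u n * √(n : ℝ))⌉₊ := by
      exact_mod_cast Nat.ceil_pos.2 (Real.exp_pos _)
    refine (Real.log_le_log h0 (natCeil_exp_le (mul_nonneg (hu n) hsq.le))).trans_eq ?_
    rw [Real.log_mul (by norm_num) (Real.exp_pos _).ne', Real.log_exp]
    field_simp
    ring

theorem corollary2 {X Y W : Type*} [MeasurableSpace X] [MeasurableSpace Y] [MeasurableSpace W]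
    (νY : Measure Y) [SigmaFinite νY] (νW : Measure W) [SigmaFinite νW]
    (pY : DensityChannel X Y νY) (pW : DensityChannel X W νW)
    (x₀ : X) (P : Measure X) [IsProbabilityMeasure P]
    (χ2 : ℝ≥0∞) (hχ2 : χ2 = chiSq νW (pW.outDens P) (fun w => (pW.dens x₀ w : ℝ≥0∞)))
    (εdet εdec : ℝ) (hdet0 : 0 < εdet) (hdet1 : εdet < 1) (hdec : 0 < εdec) :
    ∃ (M : ℕ → ℕ) (ℓ : ℝ≥0∞),
      (∀ n, 1 ≤ M n ∧
        IsLPD pW x₀ (sparseLaw x₀ P (sparseness εdet χ2 n)) n εdet ∧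
        IsReliable pY (sparseLaw x₀ P (sparseness εdet χ2 n)) n (M n) εdec) ∧
      Tendsto (fun n : ℕ => ENNReal.ofReal (Real.logb 2 (M n) / (εdet * √(n : ℝ))))
        atTop (𝓝 ℓ) ∧
      ENNReal.ofReal (2 * xiConst εdet / Real.log 2) *
        (pY.mutualInfo P / χ2 ^ (1 / 2 : ℝ)) ≤ ℓ := by
  have hlog2 : 0 < Real.log 2 := Real.log_pos (by norm_num)
  have hξ := xiConst_pos εdet
  have hprob : ∀ n, IsProbabilityMeasure (sparseLaw x₀ P (sparseness εdet χ2 n)) := fun n =>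
    isProbabilityMeasure_sparseLaw x₀ P (sparseness_le_one εdet χ2 n)
  set L := ENNReal.ofReal (2 * xiConst εdet * εdet) / χ2 ^ (1 / 2 : ℝ) * pY.mutualInfo P with hL
  obtain ⟨M, hM1, hMrel, hMlim⟩ : ∃ M : ℕ → ℕ, (∀ n, 1 ≤ M n) ∧
      (∀ n, IsReliable pY (sparseLaw x₀ P (sparseness εdet χ2 n)) n (M n) εdec) ∧
      Tendsto (fun n : ℕ => ENNReal.ofReal (Real.log (M n) / √(n : ℝ))) atTop (𝓝 L) := by
    -- For `L = 0`, which includes `χ2 = ∞`, one message suffices; otherwise positive finite rates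
    -- increase strictly to `L`, possibly infinite.
    rcases eq_zero_or_pos L with h0 | hpos
    · exact ⟨fun _ => 1, fun _ => le_rfl, fun n => pY.isReliable_one _ n εdec, by simp [h0]⟩
    obtain ⟨u, -, hu, hulim⟩ := exists_seq_strictMono_tendsto' hpos
    have hut : ∀ k, ENNReal.ofReal (u k).toReal = u k := fun k =>
      ENNReal.ofReal_toReal (hu k).2.ne_top
    have hev := fun k => pY.eventually_isReliable x₀ P hdec (εdet := εdet) (χ2 := χ2)
      (R := (u k).toReal) ENNReal.toReal_nonneg (by rw [hut]; exact (hu k).2)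
    obtain ⟨k, hk, hkrel⟩ := exists_tendsto_atTop_eventually_diagonal hev
    classical
    -- Reliability is demanded for every `n`; the fallback `1` is used for only finitely many `n`,
    -- hence does not affect the limit.
    refine ⟨fun n => if IsReliable pY (sparseLaw x₀ P (sparseness εdet χ2 n)) n
      ⌈Real.exp ((u (k n)).toReal * √(n : ℝ))⌉₊ εdec then
        ⌈Real.exp ((u (k n)).toReal * √(n : ℝ))⌉₊ else 1, fun n => ?_, fun n => ?_, ?_⟩
    · beta_reduce
      split_ifs
      · exact Nat.ceil_pos.2 (Real.exp_pos _)
      · exact le_rfl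
    · beta_reduce
      split_ifs with h
      · exact h
      · exact pY.isReliable_one _ n εdec
    · have hlim := tendsto_log_natCeil_exp_div_sqrt (u := fun n => (u (k n)).toReal)
        (fun n => ENNReal.toReal_nonneg) (L := L) (by
          simp_rw [hut]
          exact hulim.comp hk)
      refine hlim.congr' ?_
      filter_upwards [hkrel] with n hn
      rw [if_pos hn]
  -- The factor turns nats into bits and divides by `εdet`; the final inequality then holds with
  -- equality.
  refine ⟨M, ENNReal.ofReal (1 / (εdet * Real.log 2)) * L, fun n => ⟨hM1 n, ?_, hMrel n⟩, ?_, ?_⟩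
  · rw [hχ2]
    exact isLPD_sparseLaw pW x₀ P hdet0 n
  · refine (ENNReal.Tendsto.const_mul hMlim (Or.inr ENNReal.ofReal_ne_top)).congr fun n => ?_
    rw [← ENNReal.ofReal_mul (by positivity), Real.logb]
    congr 1
    ring
  · have e : ENNReal.ofReal (2 * xiConst εdet / Real.log 2) =
        ENNReal.ofReal (1 / (εdet * Real.log 2)) * ENNReal.ofReal (2 * xiConst εdet * εdet) := by
      rw [← ENNReal.ofReal_mul (by positivity)]
      congr 1
      field_simp
    simp only [e, hL, div_eq_mul_inv _ (χ2 ^ (1 / 2 : ℝ))]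
    exact le_of_eq (by ring)
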